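/- \textbf{Theorem.} Let $n$, $t$, $k$ and $\lambda$ be positive integers such that $k>\lambda+2$, $nt=\frac{k(k-1)-2}{\lambda}+1$ and $nt$ is odd. Let $p$ be an odd prime such that $p\mid k-\lambda+2$, $p\mid n$ and, if $p=3$, $9\mid k-\lambda+2$. Write $k-\lambda+2=sp^{\alpha}$ and $n=\bar n p^{\delta}$ with integers $\alpha,\delta\ge 0$ and $s,\bar n$ not divisible by $p$, and let $\left(\frac{\cdot}{p}\right)$ be the Legendre symbol. Consider the condition (L) one of the following holds: \begin{itemize} \item $\alpha$ is even, $\delta$ is odd and $\left(\frac{-s}{p}\right)=-1$; or \item $\alpha$ is odd, $\delta$ is even and $\left(\frac{(-1)^{(t-1)/2}\,2\bar n}{p}\right)=-1$; or \item $\alpha$ is odd, $\delta$ is odd and $\left(\frac{(-1)^{(t-1)/2}\,2s\bar n}{p}\right)=-1$. \end{itemize} (a) If (L) holds, then there does not exist a symmetric $(nt,k,\lambda)$-covering whose excess consists of $t$ vertex-disjoint cycles of length $n$. (b) If (L) does not hold, then $C_p(X_{(nt,k,\lambda)}[n^t])=1$ (the matrix being nondegenerate, so that $C_p$ is defined). Here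 a $(v,k,\lambda)$-covering is a set $V$ of $v$ points with a collection of $k$-subsets of $V$ (blocks, repetition allowed) such that any two distinct points $x,y$ lie together in $r_{xy}\ge\lambda$ blocks; it is symmetric if it has exactly $v$ blocks; its excess is the multigraph on $V$ in which the edge $xy$ has multiplicity $r_{xy}-\lambda$. The matrix $X_{(nt,k,\lambda)}[n^t]$ is the $nt\times nt$ matrix $\operatorname{diag}(B,\dots,B)+\lambda J$ with $t$ diagonal blocks $B$, where $J$ is the all-ones matrix and $B$ is the $n\times n$ matrix with $k-\lambda$ on the diagonal, $1$ in the positions $(i,j)$ with $i-j\equiv\pm1\pmod n$, and $0$ elsewhere (note that $n\ge 3$). An $m\times m$ matrix $X$ is nondegenerate if its $i\times i$ upper left submatrix $X_i$ is invertible for each $i\in\{1,\dots,m\}$, and then $$C_p(X)=(-1,-|X_m|)_p\prod_{i=1}^{m-1}(|X_i|,-|X_{i+1}|)_p ,$$ where $|\cdot|$ is the determinant and, for nonzero integers $a=\bar a p^{\mu}$, $b=\bar b p^{\nu}$ with $p\nmid \bar a\bar b$, the Hilbert symbol at the odd prime $p$ is $(a,b)_p=\left(\frac{-1}{p}\right)^{\mu\nu}\left(\frac{\bar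 a}{p}\right)^{\nu}\left(\frac{\bar b}{p}\right)^{\mu}$. -/

import Mathlib

namespace PairCovering

/-- A loopless multigraph on `V`: `mult x y` is the multiplicity of the edge joining `x` and `y`. -/
structure Multigraph (V : Type*) where
  mult : V → V → ℕ
  symm : ∀ x y, mult x y = mult y x
  loopless : ∀ x, mult x x = 0

/-- The cycle of length `n` (for `2 ≤ n`), with consecutive vertices `0, 1, …, n - 1`.
For `n = 2` it consists of two parallel edges. -/
def cycle (n : ℕ) : Multigraph (Fin n) where
  mult i j :=
    if i = j then 0
    else (if ((i : ℕ) + 1) % n = j then 1 else 0) + (if ((j : ℕ) + 1) % n = i then 1 else 0)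
  symm i j := by
    by_cases h : i = j
    · simp [h]
    · rw [if_neg h, if_neg (Ne.symm h), add_comm]
  loopless i := if_pos rfl

/-- `G` is the vertex-disjoint union of `t` cycles of lengths `c 0, …, c (t - 1)`, each at
least `2`: the vertices can be labelled by pairs (cycle, position on that cycle). -/
def Multigraph.HasCycleType {V : Type*} (G : Multigraph V) {t : ℕ} (c : Fin t → ℕ) : Prop :=
  (∀ i, 2 ≤ c i) ∧
  ∃ e : (Σ i, Fin (c i)) ≃ V,
    (∀ i a b, G.mult (e ⟨i, a⟩) (e ⟨i, b⟩) = (cycle (c i)).mult a b) ∧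
    (∀ i j, i ≠ j → ∀ a b, G.mult (e ⟨i, a⟩) (e ⟨j, b⟩) = 0)

/-- The number of blocks (counted with multiplicity) that contain both `x` and `y`. -/
def pairCount {V : Type*} [DecidableEq V] (blocks : Multiset (Finset V)) (x y : V) : ℕ :=
  blocks.countP (fun B => x ∈ B ∧ y ∈ B)

/-- `(V, blocks)` is a `(v, k, l)`-covering.  Repeated blocks are allowed. -/
structure IsCovering {V : Type*} [Fintype V] [DecidableEq V] (v k l : ℕ)
    (blocks : Multiset (Finset V)) : Prop where
  card_points : Fintype.card V = v
  card_block : ∀ B ∈ blocks, B.card = k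
  covers : ∀ x y, x ≠ y → l ≤ pairCount blocks x y

/-- A covering with as many blocks as points. -/
structure IsSymmetricCovering {V : Type*} [Fintype V] [DecidableEq V] (v k l : ℕ)
    (blocks : Multiset (Finset V)) : Prop extends IsCovering v k l blocks where
  card_blocks : blocks.card = v

/-- The excess: the edge `xy` has multiplicity (number of blocks containing `x` and `y`) `- l`;
in a covering this number of blocks is at least `l`, so the subtraction does not truncate. -/
def excess {V : Type*} [DecidableEq V] (l : ℕ) (blocks : Multiset (Finset V)) :
    Multigraph V where
  mult x y := if x = y then 0 else pairCount blocks x y - l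
  symm x y := by
    have h : pairCount blocks x y = pairCount blocks y x := by
      unfold pairCount
      simp only [and_comm]
    by_cases hxy : x = y
    · simp [hxy]
    · rw [if_neg hxy, if_neg (Ne.symm hxy), h]
  loopless x := if_pos rfl

/-- The matrix `B_n(a)`: `a` on the diagonal and, off the diagonal, the adjacency matrix of the
cycle of length `n` (so the off-diagonal entries of `B_2(a)` are `2`). -/
def matB (n : ℕ) (a : ℤ) : Matrix (Fin n) (Fin n) ℤ :=
  Matrix.of fun i j => if i = j then a else ((cycle n).mult i j : ℤ)

/-- The matrix `X_{(v,k,l)}[c 0, …, c (t - 1)] = diag(B_{c 0}(k - l), …) + l J_v`, where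
`v = ∑ i, c i`.  `finSigmaFinEquiv` lists the blocks one after another. -/
def matX (k l : ℕ) {t : ℕ} (c : Fin t → ℕ) :
    Matrix (Fin (∑ i, c i)) (Fin (∑ i, c i)) ℤ :=
  Matrix.reindex finSigmaFinEquiv finSigmaFinEquiv
    (Matrix.blockDiagonal' fun i => matB (c i) ((k : ℤ) - l)) + Matrix.of fun _ _ => (l : ℤ)

/-- The determinant of the `i × i` leading principal submatrix, for `i ≤ m`. -/
def leadingMinor {m : ℕ} (X : Matrix (Fin m) (Fin m) ℤ) (i : ℕ) : ℤ :=
  if h : i ≤ m then (X.submatrix (Fin.castLE h) (Fin.castLE h)).det else 0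

/-- All leading principal submatrices of sizes `1, …, m` are invertible over `ℚ`. -/
def Nondegenerate {m : ℕ} (X : Matrix (Fin m) (Fin m) ℤ) : Prop :=
  ∀ i, 1 ≤ i → i ≤ m → leadingMinor X i ≠ 0

/-- The prime-to-`p` part `ā` in the `p`-factorisation `a = ā p ^ α` of a nonzero integer; the
exponent is `α = padicValInt p a`. -/
def primeToPart (p : ℕ) (a : ℤ) : ℤ := a / (p : ℤ) ^ padicValInt p a

/-- The Hilbert symbol `(a, b)_p` of nonzero integers at a prime `p`. -/
def hilbert (p : ℕ) [Fact p.Prime] (a b : ℤ) : ℤ :=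
  if p = 2 then
    (((primeToPart 2 a - 1) * (primeToPart 2 b - 1) / 4
      + padicValInt 2 a * ((primeToPart 2 b ^ 2 - 1) / 8)
      + padicValInt 2 b * ((primeToPart 2 a ^ 2 - 1) / 8)).negOnePow : ℤ)
  else
    legendreSym p (-1) ^ (padicValInt p a * padicValInt p b)
      * legendreSym p (primeToPart p a) ^ padicValInt p b
      * legendreSym p (primeToPart p b) ^ padicValInt p a

/-- The Hasse–Minkowski invariant
`C_p(X) = (-1, -|X_m|)_p ∏_{i=1}^{m-1} (|X_i|, -|X_{i+1}|)_p` of a nondegenerate matrix. -/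
def hasseMinkowski (p : ℕ) [Fact p.Prime] {m : ℕ} (X : Matrix (Fin m) (Fin m) ℤ) : ℤ :=
  hilbert p (-1) (-leadingMinor X m)
    * ∏ i ∈ Finset.Ico 1 m, hilbert p (leadingMinor X i) (-leadingMinor X (i + 1))

/-- The three alternative Legendre symbol conditions, for the `p`-factorisations `s p ^ α` of
`k - l + 2` and `nbar p ^ δ` of `n`. -/
def LegendreCondition (p : ℕ) [Fact p.Prime] (t s α nbar δ : ℕ) : Prop :=
  (Even α ∧ Odd δ ∧ legendreSym p (-(s : ℤ)) = -1) ∨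
  (Odd α ∧ Even δ ∧ legendreSym p ((-1) ^ ((t - 1) / 2) * 2 * (nbar : ℤ)) = -1) ∨
  (Odd α ∧ Odd δ ∧ legendreSym p ((-1) ^ ((t - 1) / 2) * 2 * (s : ℤ) * (nbar : ℤ)) = -1)

end PairCovering

/-! Put y = k - λ + 2, so that the condition on nt reads k² = y + λnt. Number the points along the
cycles. Double counting forces every point of such a covering into exactly k blocks, so its
incidence matrix N satisfies N Nᵀ = X. Since N is square, the rational quadratic form of X is then a
sum of nt squares, and its Hasse invariant at p (the product of (a_i, a_j)_p over i < j for a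
diagonalisation) is 1. Everything reduces to evaluating this invariant.

It is independent of the orthogonal basis: X is positive definite because k - λ > 2, so any nonzero
vector can be exchanged into an orthogonal basis by changes inside planes, and each such change
rests on (a, b)_p = 1 for a + b = 1 (`ratHilbert_eq_one_of_add_eq_one`, `sameClass_of_listSpan_eq`).
Gram–Schmidt shows that C_p(X) is the Hasse invariant times (-1, -disc)_p.

For the evaluation, the leading minors of B of size below n are, up to sign, terms of the Lucas
sequence S_{m+2} = (2 - y) S_{m+1} - S_m. As p ∣ y, S_m ≡ m modulo p, and S_n has the same p-power
as n and a congruent unit part; this is where p = 3 needs 9 ∣ y. Hence the sum-zero vectors of one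
cycle form a space of discriminant n and trivial Hasse invariant (`exists_isOrthoList_one_cons`). In
the form of X the t sum-zero spaces and the space of vectors constant on cycles are mutually
orthogonal, and the latter has an explicit orthogonal basis ending in the all-ones vector, of norm
k²nt. With t = 2e + 1 the total discriminant is a square and the invariant is (n, -1)(y, t)(y, -1)^e
(`exists_isOrthoList_blockForm`).

Finally y/k² + λnt/k² = 1 gives (y, t) = (y, λ)(y, n), and p ∣ k gives λ ≡ 2 modulo p. In Legendre
symbols the value is -1 exactly under (L). -/

namespace PairCovering

/-! ### Hilbert symbols at an odd prime, for integers and for rationals. -/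

section HilbertSymbol

variable {p : ℕ} [Fact p.Prime]

theorem padicValInt_eq_and_primeToPart_eq {a u : ℤ} {m : ℕ} (h : a = u * (p : ℤ) ^ m)
    (hu : ¬ (p : ℤ) ∣ u) : padicValInt p a = m ∧ primeToPart p a = u := by
  have hp : (p : ℤ) ≠ 0 := by exact_mod_cast (Fact.out : p.Prime).ne_zero
  have hu0 : u ≠ 0 := by rintro rfl; exact hu (dvd_zero _)
  have hv : padicValInt p a = m := by
    rw [h, padicValInt.mul hu0 (pow_ne_zero _ hp), padicValInt.eq_zero_of_not_dvd hu]
    have : padicValInt p ((p : ℤ) ^ m) = m := by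
      simp [padicValInt, Int.natAbs_pow]
    omega
  refine ⟨hv, ?_⟩
  unfold primeToPart
  rw [hv, h]
  exact Int.mul_ediv_cancel _ (pow_ne_zero _ hp)

theorem exists_eq_mul_pow {a : ℤ} (ha : a ≠ 0) :
    ∃ (u : ℤ) (m : ℕ), a = u * (p : ℤ) ^ m ∧ ¬ (p : ℤ) ∣ u := by
  have hp : Prime (p : ℤ) := Nat.prime_iff_prime_int.mp Fact.out
  have hf : FiniteMultiplicity (p : ℤ) a :=
    Int.finiteMultiplicity_iff.mpr ⟨by simpa using (Fact.out : p.Prime).ne_one, ha⟩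
  obtain ⟨u, hu, hu'⟩ := hf.exists_eq_pow_mul_and_not_dvd
  exact ⟨u, _, by rw [mul_comm]; exact hu, hu'⟩

theorem hilbert_eq (hp2 : p ≠ 2) {a b u w : ℤ} {m r : ℕ} (ha : a = u * (p : ℤ) ^ m)
    (hu : ¬ (p : ℤ) ∣ u) (hb : b = w * (p : ℤ) ^ r) (hw : ¬ (p : ℤ) ∣ w) :
    hilbert p a b = legendreSym p (-1) ^ (m * r) * legendreSym p u ^ r * legendreSym p w ^ m := by
  obtain ⟨h1, h2⟩ := padicValInt_eq_and_primeToPart_eq ha hu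
  obtain ⟨h3, h4⟩ := padicValInt_eq_and_primeToPart_eq hb hw
  rw [hilbert, if_neg hp2, h1, h2, h3, h4]

theorem legendreSym_mul_self {u : ℤ} (hu : ¬ (p : ℤ) ∣ u) :
    legendreSym p u * legendreSym p u = 1 := by
  rw [← sq]
  exact legendreSym.sq_one p (by rwa [Ne, ZMod.intCast_zmod_eq_zero_iff_dvd])

theorem legendreSym_congr {a b : ℤ} (h : (p : ℤ) ∣ a - b) : legendreSym p a = legendreSym p b := by
  rw [legendreSym.mod p a, legendreSym.mod p b]
  congr 1
  exact (Int.modEq_iff_dvd.mpr h).symm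

theorem hilbert_comm (hp2 : p ≠ 2) {a b : ℤ} (ha : a ≠ 0) (hb : b ≠ 0) :
    hilbert p a b = hilbert p b a := by
  obtain ⟨u, m, h1, h2⟩ := exists_eq_mul_pow (p := p) ha
  obtain ⟨w, r, h3, h4⟩ := exists_eq_mul_pow (p := p) hb
  rw [hilbert_eq hp2 h1 h2 h3 h4, hilbert_eq hp2 h3 h4 h1 h2, mul_comm m r]
  ring

theorem not_dvd_mul {a b : ℤ} (ha : ¬ (p : ℤ) ∣ a) (hb : ¬ (p : ℤ) ∣ b) : ¬ (p : ℤ) ∣ a * b := by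
  have hp : Prime (p : ℤ) := Nat.prime_iff_prime_int.mp Fact.out
  intro h
  rcases hp.dvd_or_dvd h with h | h <;> contradiction

theorem hilbert_mul_left (hp2 : p ≠ 2) {a b c : ℤ} (ha : a ≠ 0) (hb : b ≠ 0) (hc : c ≠ 0) :
    hilbert p (a * b) c = hilbert p a c * hilbert p b c := by
  obtain ⟨u, m, h1, h2⟩ := exists_eq_mul_pow (p := p) ha
  obtain ⟨w, r, h3, h4⟩ := exists_eq_mul_pow (p := p) hb
  obtain ⟨x, s, h5, h6⟩ := exists_eq_mul_pow (p := p) hc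
  have h7 : a * b = (u * w) * (p : ℤ) ^ (m + r) := by rw [h1, h3]; ring
  rw [hilbert_eq hp2 h7 (not_dvd_mul h2 h4) h5 h6, hilbert_eq hp2 h1 h2 h5 h6,
    hilbert_eq hp2 h3 h4 h5 h6, legendreSym.mul]
  ring

theorem hilbert_mul_right (hp2 : p ≠ 2) {a b c : ℤ} (ha : a ≠ 0) (hb : b ≠ 0) (hc : c ≠ 0) :
    hilbert p c (a * b) = hilbert p c a * hilbert p c b := by
  rw [hilbert_comm hp2 hc (mul_ne_zero ha hb), hilbert_mul_left hp2 ha hb hc,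
    hilbert_comm hp2 ha hc, hilbert_comm hp2 hb hc]

theorem not_dvd_neg_one : ¬ (p : ℤ) ∣ -1 := by
  rw [dvd_neg, Int.natCast_dvd_ofNat]
  exact (Fact.out : p.Prime).not_dvd_one

theorem hilbert_mul_self (hp2 : p ≠ 2) {a b : ℤ} (ha : a ≠ 0) (hb : b ≠ 0) :
    hilbert p a b * hilbert p a b = 1 := by
  obtain ⟨u, m, h1, h2⟩ := exists_eq_mul_pow (p := p) ha
  obtain ⟨w, r, h3, h4⟩ := exists_eq_mul_pow (p := p) hb
  rw [hilbert_eq hp2 h1 h2 h3 h4]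
  calc _ = (legendreSym p (-1) * legendreSym p (-1)) ^ (m * r)
        * (legendreSym p u * legendreSym p u) ^ r * (legendreSym p w * legendreSym p w) ^ m := by
        ring
    _ = 1 := by
        rw [legendreSym_mul_self h2, legendreSym_mul_self h4, legendreSym_mul_self not_dvd_neg_one]
        simp

theorem hilbert_self (hp2 : p ≠ 2) {a : ℤ} (ha : a ≠ 0) : hilbert p a a = hilbert p a (-1) := by
  obtain ⟨u, m, h1, h2⟩ := exists_eq_mul_pow (p := p) ha
  rw [hilbert_eq hp2 h1 h2 h1 h2,
    hilbert_eq hp2 h1 h2 (show (-1 : ℤ) = -1 * (p : ℤ) ^ 0 by simp) not_dvd_neg_one]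
  have h3 : legendreSym p u ^ m * legendreSym p u ^ m = 1 := by
    rw [← mul_pow, legendreSym_mul_self h2, one_pow]
  rw [mul_assoc, h3, mul_one, mul_zero, pow_zero, pow_zero, one_mul, one_mul, pow_mul]
  rcases Nat.even_or_odd m with hm | hm
  · have : legendreSym p (-1) ^ m = 1 := by
      obtain ⟨j, rfl⟩ := hm
      rw [pow_add, ← mul_pow, legendreSym_mul_self not_dvd_neg_one, one_pow]
    rw [this, one_pow]
  · obtain ⟨j, rfl⟩ := hm
    have : legendreSym p (-1) ^ (2 * j + 1) = legendreSym p (-1) := by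
      rw [pow_succ, pow_mul, sq, legendreSym_mul_self not_dvd_neg_one, one_pow, one_mul]
    rw [this, this]

theorem hilbert_eq_one_of_not_dvd (hp2 : p ≠ 2) {a b : ℤ} (ha : ¬ (p : ℤ) ∣ a)
    (hb : ¬ (p : ℤ) ∣ b) : hilbert p a b = 1 := by
  rw [hilbert_eq hp2 (show a = a * (p : ℤ) ^ 0 by simp) ha (show b = b * (p : ℤ) ^ 0 by simp) hb]
  simp

/-- A unit that is a square modulo an odd `p` is a `p`-adic square, so it pairs trivially with
everything. -/
theorem hilbert_eq_one_of_dvd_sub_sq (hp2 : p ≠ 2) {a b c : ℤ} (ha : a ≠ 0)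
    (hc : ¬ (p : ℤ) ∣ c) (h : (p : ℤ) ∣ b - c * c) : hilbert p a b = 1 := by
  obtain ⟨u, m, h1, h2⟩ := exists_eq_mul_pow (p := p) ha
  have hb : ¬ (p : ℤ) ∣ b := fun h' => not_dvd_mul hc hc ((dvd_sub_right h').mp h)
  rw [hilbert_eq hp2 h1 h2 (show b = b * (p : ℤ) ^ 0 by simp) hb, legendreSym_congr h,
    legendreSym.mul, legendreSym_mul_self hc]
  simp

/-- The Hilbert symbol of two nonzero rational numbers, each replaced by an integer in its
square class. -/
def ratHilbert (p : ℕ) [Fact p.Prime] (a b : ℚ) : ℤ :=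
  hilbert p (a.num * a.den) (b.num * b.den)

/-- Symbols see only square classes. This makes `ratHilbert` multiplicative although numerator times
denominator is not. -/
theorem hilbert_congr_left (hp2 : p ≠ 2) {x y s t z : ℤ} (hx : x ≠ 0) (hy : y ≠ 0) (hs : s ≠ 0)
    (ht : t ≠ 0) (hz : z ≠ 0) (h : x * (s * s) = y * (t * t)) : hilbert p x z = hilbert p y z := by
  have h1 : hilbert p (x * (s * s)) z = hilbert p x z := by
    rw [hilbert_mul_left hp2 hx (mul_ne_zero hs hs) hz, hilbert_mul_left hp2 hs hs hz,
      hilbert_mul_self hp2 hs hz, mul_one]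
  have h2 : hilbert p (y * (t * t)) z = hilbert p y z := by
    rw [hilbert_mul_left hp2 hy (mul_ne_zero ht ht) hz, hilbert_mul_left hp2 ht ht hz,
      hilbert_mul_self hp2 ht hz, mul_one]
  rw [← h1, ← h2, h]

theorem num_mul_den_ne_zero {a : ℚ} (ha : a ≠ 0) : a.num * (a.den : ℤ) ≠ 0 :=
  mul_ne_zero (Rat.num_ne_zero.mpr ha) (by exact_mod_cast a.den_ne_zero)

theorem num_mul_den_cast (a : ℚ) : ((a.num * (a.den : ℤ) : ℤ) : ℚ) = a * (a.den : ℚ) ^ 2 := by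
  have h := Rat.mul_den_eq_num a
  push_cast
  rw [← h]; ring

theorem ratHilbert_comm (hp2 : p ≠ 2) {a b : ℚ} (ha : a ≠ 0) (hb : b ≠ 0) :
    ratHilbert p a b = ratHilbert p b a :=
  hilbert_comm hp2 (num_mul_den_ne_zero ha) (num_mul_den_ne_zero hb)

theorem ratHilbert_mul_left (hp2 : p ≠ 2) {a b c : ℚ} (ha : a ≠ 0) (hb : b ≠ 0) (hc : c ≠ 0) :
    ratHilbert p (a * b) c = ratHilbert p a c * ratHilbert p b c := by
  unfold ratHilbert
  rw [← hilbert_mul_left hp2 (num_mul_den_ne_zero ha) (num_mul_den_ne_zero hb)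
    (num_mul_den_ne_zero hc)]
  refine hilbert_congr_left hp2 (s := a.den * b.den) (t := (a * b).den)
    (num_mul_den_ne_zero (mul_ne_zero ha hb))
    (mul_ne_zero (num_mul_den_ne_zero ha) (num_mul_den_ne_zero hb)) (by positivity)
    (by positivity) (num_mul_den_ne_zero hc) ?_
  have : (((a * b).num * (a * b).den * ((a.den * b.den : ℤ) * (a.den * b.den : ℤ)) : ℤ) : ℚ)
      = ((a.num * a.den * (b.num * b.den) * (((a * b).den : ℤ) * ((a * b).den : ℤ)) : ℤ) : ℚ) := by
    have ha' := num_mul_den_cast a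
    have hb' := num_mul_den_cast b
    have hab' := num_mul_den_cast (a * b)
    push_cast at ha' hb' hab' ⊢
    rw [ha', hb', hab']
    ring
  exact_mod_cast this

theorem ratHilbert_mul_right (hp2 : p ≠ 2) {a b c : ℚ} (ha : a ≠ 0) (hb : b ≠ 0) (hc : c ≠ 0) :
    ratHilbert p c (a * b) = ratHilbert p c a * ratHilbert p c b := by
  rw [ratHilbert_comm hp2 hc (mul_ne_zero ha hb), ratHilbert_mul_left hp2 ha hb hc,
    ratHilbert_comm hp2 ha hc, ratHilbert_comm hp2 hb hc]

theorem ratHilbert_mul_self (hp2 : p ≠ 2) {a b : ℚ} (ha : a ≠ 0) (hb : b ≠ 0) :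
    ratHilbert p a b * ratHilbert p a b = 1 :=
  hilbert_mul_self hp2 (num_mul_den_ne_zero ha) (num_mul_den_ne_zero hb)

theorem ratHilbert_intCast (a b : ℤ) : ratHilbert p a b = hilbert p a b := by
  simp [ratHilbert]

theorem ratHilbert_self (hp2 : p ≠ 2) {a : ℚ} (ha : a ≠ 0) :
    ratHilbert p a a = ratHilbert p a (-1) := by
  have := hilbert_self hp2 (num_mul_den_ne_zero ha)
  simpa [ratHilbert] using this

theorem ratHilbert_sq_left (hp2 : p ≠ 2) {a c : ℚ} (ha : a ≠ 0) (hc : c ≠ 0) :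
    ratHilbert p (c ^ 2) a = 1 := by
  rw [sq, ratHilbert_mul_left hp2 hc hc ha, ratHilbert_mul_self hp2 hc ha]

theorem ratHilbert_sq_right (hp2 : p ≠ 2) {a c : ℚ} (ha : a ≠ 0) (hc : c ≠ 0) :
    ratHilbert p a (c ^ 2) = 1 := by
  rw [ratHilbert_comm hp2 ha (pow_ne_zero 2 hc), ratHilbert_sq_left hp2 ha hc]

theorem ratHilbert_sq_mul_left (hp2 : p ≠ 2) {a b c : ℚ} (ha : a ≠ 0) (hb : b ≠ 0) (hc : c ≠ 0) :
    ratHilbert p (c ^ 2 * a) b = ratHilbert p a b := by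
  rw [ratHilbert_mul_left hp2 (pow_ne_zero 2 hc) ha hb, ratHilbert_sq_left hp2 hb hc, one_mul]

theorem ratHilbert_sq_mul_right (hp2 : p ≠ 2) {a b c : ℚ} (ha : a ≠ 0) (hb : b ≠ 0) (hc : c ≠ 0) :
    ratHilbert p b (c ^ 2 * a) = ratHilbert p b a := by
  rw [ratHilbert_mul_right hp2 (pow_ne_zero 2 hc) ha hb, ratHilbert_sq_right hp2 hb hc, one_mul]

/-- With `a = A / C` in lowest terms, `A`, `C - A` and `C` are pairwise coprime, so `p` divides at
most one of them. The symbol then pairs that one with the product of the other two, up to sign, and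
this product is a nonzero square modulo `p`. -/
theorem ratHilbert_eq_one_of_add_eq_one (hp2 : p ≠ 2) {a b : ℚ} (ha : a ≠ 0) (hb : b ≠ 0)
    (hab : a + b = 1) : ratHilbert p a b = 1 := by
  have hp : Prime (p : ℤ) := Nat.prime_iff_prime_int.mp Fact.out
  obtain ⟨A, C, hA, hC, hAC, h⟩ : ∃ A C : ℤ, A ≠ 0 ∧ C ≠ 0 ∧ IsCoprime A C ∧ a = A / C :=
    ⟨a.num, a.den, Rat.num_ne_zero.mpr ha, by exact_mod_cast a.den_ne_zero,
      Rat.isCoprime_num_den a, (Rat.num_div_den a).symm⟩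
  have hC' : (C : ℚ) ≠ 0 := by exact_mod_cast hC
  have hA' : (A : ℚ) ≠ 0 := by exact_mod_cast hA
  have hB : b = ((C - A : ℤ) : ℚ) / C := by
    rw [eq_sub_of_add_eq' hab, h]; push_cast; field_simp
  have hB0 : C - A ≠ 0 := by
    rintro h0; rw [h0] at hB; simp at hB; exact hb hB
  have hB0' : ((C - A : ℤ) : ℚ) ≠ 0 := by exact_mod_cast hB0
  have key : ratHilbert p a b = hilbert p (A * C) ((C - A) * C) := by
    rw [← ratHilbert_intCast]
    have h1 : ((A * C : ℤ) : ℚ) = (C : ℚ) ^ 2 * a := by rw [h]; push_cast; field_simp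
    have h2 : (((C - A) * C : ℤ) : ℚ) = (C : ℚ) ^ 2 * b := by
      rw [hB]; push_cast; field_simp
    rw [h1, h2, ratHilbert_sq_mul_left hp2 ha (by positivity) hC',
      ratHilbert_sq_mul_right hp2 hb ha hC']
  have hnot : ∀ x y : ℤ, IsCoprime x y → (p : ℤ) ∣ x → ¬ (p : ℤ) ∣ y := fun x y hxy h1 h2 =>
    hp.not_isUnit (hxy.isUnit_of_dvd' h1 h2)
  rw [key, hilbert_mul_left hp2 hA hC (mul_ne_zero hB0 hC), hilbert_mul_right hp2 hB0 hC hA,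
    hilbert_mul_right hp2 hB0 hC hC, hilbert_self hp2 hC]
  by_cases h1 : (p : ℤ) ∣ C
  · have h2 : ¬ (p : ℤ) ∣ A := hnot _ _ hAC.symm h1
    have h3 : ¬ (p : ℤ) ∣ C - A := fun h' => h2 ((dvd_sub_right h1).mp h')
    rw [hilbert_eq_one_of_not_dvd hp2 h2 h3, hilbert_comm hp2 hA hC, one_mul,
      mul_comm (hilbert p C (C - A)),
      ← hilbert_mul_right hp2 (by norm_num) hB0 hC,
      ← hilbert_mul_right hp2 hA (mul_ne_zero (by norm_num) hB0) hC]
    refine hilbert_eq_one_of_dvd_sub_sq hp2 hC h2 ?_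
    rw [show A * (-1 * (C - A)) - A * A = C * (-A) by ring]
    exact h1.mul_right _
  by_cases h2 : (p : ℤ) ∣ A
  · have h3 : ¬ (p : ℤ) ∣ C - A := fun h' => h1 ((dvd_sub_left h2).mp h')
    rw [hilbert_eq_one_of_not_dvd hp2 h1 h3, hilbert_eq_one_of_not_dvd hp2 h1 not_dvd_neg_one,
      mul_one, mul_one, ← hilbert_mul_right hp2 hB0 hC hA]
    refine hilbert_eq_one_of_dvd_sub_sq hp2 hA h1 ?_
    rw [show (C - A) * C - C * C = A * (-C) by ring]
    exact h2.mul_right _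
  · rw [hilbert_eq_one_of_not_dvd hp2 h2 h1, hilbert_eq_one_of_not_dvd hp2 h1 not_dvd_neg_one,
      mul_one, mul_one, ← hilbert_mul_left hp2 hA hC hB0, hilbert_comm hp2 (mul_ne_zero hA hC) hB0]
    by_cases h3 : (p : ℤ) ∣ C - A
    · refine hilbert_eq_one_of_dvd_sub_sq hp2 hB0 h2 ?_
      rw [show A * C - A * A = (C - A) * A by ring]
      exact h3.mul_right _
    · exact hilbert_eq_one_of_not_dvd hp2 h3 (not_dvd_mul h2 h1)

/-- Dividing by the sum reduces to two numbers with sum 1. This is the Hasse invariant's half of the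
equivalence of the binary forms ⟨a, b⟩ and ⟨a + b, ab(a + b)⟩. -/
theorem ratHilbert_add (hp2 : p ≠ 2) {a b : ℚ} (ha : a ≠ 0) (hb : b ≠ 0) (hs : a + b ≠ 0) :
    ratHilbert p (a + b) (a * b * (a + b)) = ratHilbert p a b := by
  set s := a + b with hs_def
  have h1 : ratHilbert p (a / s) (b / s) = 1 :=
    ratHilbert_eq_one_of_add_eq_one hp2 (div_ne_zero ha hs) (div_ne_zero hb hs)
      (by rw [← add_div, ← hs_def, div_self hs])
  have hi : s⁻¹ ≠ 0 := inv_ne_zero hs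
  rw [show a / s = s⁻¹ ^ 2 * (a * s) by field_simp, show b / s = s⁻¹ ^ 2 * (b * s) by field_simp,
    ratHilbert_sq_mul_left hp2 (mul_ne_zero ha hs) (by positivity) hi,
    ratHilbert_sq_mul_right hp2 (mul_ne_zero hb hs) (mul_ne_zero ha hs) hi,
    ratHilbert_mul_left hp2 ha hs (mul_ne_zero hb hs), ratHilbert_mul_right hp2 hb hs ha,
    ratHilbert_mul_right hp2 hb hs hs] at h1
  rw [ratHilbert_mul_right hp2 (mul_ne_zero ha hb) hs hs, ratHilbert_mul_right hp2 ha hb hs,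
    ratHilbert_comm hp2 hs ha]
  have h2 := ratHilbert_mul_self (p := p) hp2 ha hb
  linear_combination (ratHilbert p a b) * h1
    - (ratHilbert p a s * ratHilbert p s b * ratHilbert p s s) * h2

theorem ratHilbert_neg_self (hp2 : p ≠ 2) {a : ℚ} (ha : a ≠ 0) : ratHilbert p a (-a) = 1 := by
  rw [← neg_one_mul, ratHilbert_mul_right hp2 (by norm_num) ha ha, ratHilbert_self hp2 ha,
    ratHilbert_mul_self hp2 ha (by norm_num)]

theorem ratHilbert_one_left (hp2 : p ≠ 2) {a : ℚ} (ha : a ≠ 0) : ratHilbert p 1 a = 1 := by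
  rw [← ratHilbert_sq_left (p := p) hp2 ha one_ne_zero, one_pow]

theorem ratHilbert_one_right (hp2 : p ≠ 2) {a : ℚ} (ha : a ≠ 0) : ratHilbert p a 1 = 1 := by
  rw [← ratHilbert_sq_right (p := p) hp2 ha one_ne_zero, one_pow]

end HilbertSymbol

end PairCovering

namespace PairCovering

/-! ### Orthogonal bases and the invariance of the Hasse invariant. -/

section OrthogonalLists

variable (p : ℕ) [Fact p.Prime]

/-- The Hasse invariant `∏_{i < j} (a_i, a_j)_p` of the diagonal form with the given
coefficients. -/
def hasse : List ℚ → ℤ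
  | [] => 1
  | a :: l => ratHilbert p a l.prod * hasse l

/-- Equality of the Hasse invariants, and of the discriminants up to squares. -/
def SameClass (L M : List ℚ) : Prop :=
  hasse p L = hasse p M ∧ ∃ c : ℚ, c ≠ 0 ∧ M.prod = c ^ 2 * L.prod

variable {p}

theorem SameClass.refl (L : List ℚ) : SameClass p L L := ⟨rfl, 1, by simp, by simp⟩

theorem SameClass.trans {L M N : List ℚ} (h : SameClass p L M) (h' : SameClass p M N) :
    SameClass p L N := by
  obtain ⟨h1, c, hc, h2⟩ := h
  obtain ⟨h3, d, hd, h4⟩ := h'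
  exact ⟨h1.trans h3, d * c, mul_ne_zero hd hc, by rw [h4, h2]; ring⟩

theorem SameClass.cons (hp2 : p ≠ 2) {L M : List ℚ} (h : SameClass p L M) {a : ℚ} (ha : a ≠ 0)
    (hL : L.prod ≠ 0) : SameClass p (a :: L) (a :: M) := by
  obtain ⟨h1, c, hc, h2⟩ := h
  refine ⟨?_, c, hc, ?_⟩
  · rw [hasse, hasse, h1, h2, ratHilbert_sq_mul_right hp2 hL ha hc]
  · rw [List.prod_cons, List.prod_cons, h2]; ring

theorem sameClass_cons_sq_mul (hp2 : p ≠ 2) {L : List ℚ} {a c : ℚ} (ha : a ≠ 0) (hc : c ≠ 0)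
    (hL : L.prod ≠ 0) : SameClass p (a :: L) ((c ^ 2 * a) :: L) := by
  refine ⟨?_, c, hc, ?_⟩
  · rw [hasse, hasse, ratHilbert_sq_mul_left hp2 ha hL hc]
  · rw [List.prod_cons, List.prod_cons]; ring

/-- If `e`, `z` are orthogonal of norms `a`, `b`, then the two new entries are the norms of `c • e +
z` and of a vector orthogonal to it in the same plane. For `c = 0` the factor `c ^ 2` cannot be
removed as a square, and the plane is merely reordered. -/
theorem sameClass_cons_cons (hp2 : p ≠ 2) {L : List ℚ} {a b c : ℚ} (ha : a ≠ 0) (hb : b ≠ 0)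
    (hs : c ^ 2 * a + b ≠ 0) (hL : L.prod ≠ 0) :
    SameClass p (a :: b :: L) ((c ^ 2 * a + b) :: (a * b * (c ^ 2 * a + b)) :: L) := by
  set s := c ^ 2 * a + b with hs_def
  refine ⟨?_, s, hs, by simp only [List.prod_cons]; ring⟩
  have hab : a * b ≠ 0 := mul_ne_zero ha hb
  have key : ratHilbert p s (a * b * s) = ratHilbert p a b := by
    by_cases hc : c = 0
    · have : s = b := by rw [hs_def, hc]; ring
      rw [this, show a * b * b = b ^ 2 * a by ring, ratHilbert_sq_mul_right hp2 ha hb hb,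
        ratHilbert_comm hp2 hb ha]
    · have h := ratHilbert_add (p := p) hp2 (a := c ^ 2 * a) (mul_ne_zero (pow_ne_zero 2 hc) ha) hb hs
      rw [ratHilbert_sq_mul_left hp2 ha hb hc, ← hs_def,
        show c ^ 2 * a * b * s = c ^ 2 * (a * b * s) by ring,
        ratHilbert_sq_mul_right hp2 (mul_ne_zero hab hs) hs hc] at h
      exact h
  simp only [hasse, List.prod_cons]
  rw [ratHilbert_mul_right hp2 (mul_ne_zero hab hs) hL hs, key,
    ratHilbert_mul_left hp2 hab hs hL, ratHilbert_mul_left hp2 ha hb hL,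
    ratHilbert_mul_right hp2 hb hL ha]
  linear_combination (-(ratHilbert p a b * ratHilbert p a L.prod * ratHilbert p b L.prod *
    hasse p L)) * ratHilbert_mul_self (p := p) hp2 hs hL

theorem hasse_append (hp2 : p ≠ 2) {L M : List ℚ} (hL : ∀ a ∈ L, a ≠ 0) (hM : M.prod ≠ 0) :
    hasse p (L ++ M) = hasse p L * hasse p M * ratHilbert p L.prod M.prod := by
  induction L with
  | nil =>
    simp [hasse, ratHilbert_one_left hp2 hM]
  | cons a L ih =>
    have ha : a ≠ 0 := hL a (by simp)
    have hL' : ∀ a ∈ L, a ≠ 0 := fun x hx => hL x (by simp [hx])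
    have hP : L.prod ≠ 0 := List.prod_ne_zero fun h => hL' 0 h rfl
    rw [List.cons_append, hasse, hasse, ih hL', List.prod_append, List.prod_cons,
      ratHilbert_mul_right hp2 hP hM ha, ratHilbert_mul_left hp2 ha hP hM]
    ring

variable {V : Type*} [AddCommGroup V] [Module ℚ V]

/-- A symmetric positive definite bilinear form over `ℚ`. -/
structure IsPosDefForm (β : LinearMap.BilinForm ℚ V) : Prop where
  symm : ∀ x y, β x y = β y x
  pos : ∀ x, x ≠ 0 → 0 < β x x

/-- A list of nonzero pairwise orthogonal vectors. -/
structure IsOrthoList (β : LinearMap.BilinForm ℚ V) (l : List V) : Prop where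
  ortho : l.Pairwise fun x y => β x y = 0
  ne_zero : ∀ x ∈ l, x ≠ 0

/-- The values of the quadratic form on a list of vectors. -/
def norms (β : LinearMap.BilinForm ℚ V) (l : List V) : List ℚ := l.map fun x => β x x

/-- The span of the members of a list. -/
def listSpan (l : List V) : Submodule ℚ V := Submodule.span ℚ {x | x ∈ l}

theorem listSpan_cons (x : V) (l : List V) : listSpan (x :: l) = ℚ ∙ x ⊔ listSpan l := by
  rw [listSpan, listSpan, ← Submodule.span_union]
  congr 1
  ext y
  simp

theorem listSpan_le {l : List V} {W : Submodule ℚ V} : listSpan l ≤ W ↔ ∀ x ∈ l, x ∈ W :=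
  Submodule.span_le

theorem mem_listSpan {l : List V} {x : V} (h : x ∈ l) : x ∈ listSpan l :=
  Submodule.subset_span h

theorem mem_listSpan_cons {x y : V} {l : List V} :
    y ∈ listSpan (x :: l) ↔ ∃ c : ℚ, ∃ z ∈ listSpan l, y = c • x + z := by
  rw [listSpan_cons, Submodule.mem_sup]
  constructor
  · rintro ⟨_, h, z, hz, rfl⟩
    obtain ⟨c, rfl⟩ := Submodule.mem_span_singleton.mp h
    exact ⟨c, z, hz, rfl⟩
  · rintro ⟨c, z, hz, rfl⟩
    exact ⟨_, Submodule.mem_span_singleton.mpr ⟨c, rfl⟩, z, hz, rfl⟩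

variable {β : LinearMap.BilinForm ℚ V}

theorem eq_zero_of_mem_listSpan {x y : V} {l : List V} (h : ∀ z ∈ l, β x z = 0)
    (hy : y ∈ listSpan l) : β x y = 0 := by
  have : listSpan l ≤ LinearMap.ker (β x) := listSpan_le.mpr h
  exact this hy

theorem isOrthoList_cons {x : V} {l : List V} :
    IsOrthoList β (x :: l) ↔ (x ≠ 0 ∧ ∀ y ∈ l, β x y = 0) ∧ IsOrthoList β l := by
  constructor
  · rintro ⟨h1, h2⟩
    rw [List.pairwise_cons] at h1
    exact ⟨⟨h2 x (by simp), h1.1⟩, h1.2, fun y hy => h2 y (by simp [hy])⟩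
  · rintro ⟨⟨h1, h2⟩, h3, h4⟩
    exact ⟨List.pairwise_cons.mpr ⟨h2, h3⟩, by simpa using ⟨h1, h4⟩⟩

theorem norms_ne_zero (hβ : IsPosDefForm β) {l : List V} (hl : IsOrthoList β l) :
    ∀ a ∈ norms β l, a ≠ 0 := by
  intro a ha
  obtain ⟨x, hx, rfl⟩ := List.mem_map.mp ha
  exact (hβ.pos x (hl.ne_zero x hx)).ne'

theorem norms_prod_ne_zero (hβ : IsPosDefForm β) {l : List V} (hl : IsOrthoList β l) :
    (norms β l).prod ≠ 0 :=
  List.prod_ne_zero fun h => norms_ne_zero hβ hl 0 h rfl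

/-- Write `w = c • e + z` with `z` in the span of the tail. By induction `z` can be made the first
vector of the tail, after which only the plane of `e` and `z` changes. Positive definiteness
excludes isotropic vectors on the way. -/
theorem exists_isOrthoList_cons (hp2 : p ≠ 2) (hβ : IsPosDefForm β) (l : List V)
    (hl : IsOrthoList β l) (w : V) (hw : w ∈ listSpan l) (hw0 : w ≠ 0) :
    ∃ m, IsOrthoList β (w :: m) ∧ listSpan (w :: m) = listSpan l ∧
      SameClass p (norms β l) (norms β (w :: m)) := by
  induction l generalizing w with
  | nil => simp [listSpan] at hw; contradiction
  | cons e l ih =>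
    obtain ⟨⟨he0, he⟩, hl'⟩ := isOrthoList_cons.mp hl
    obtain ⟨c, z, hz, rfl⟩ := mem_listSpan_cons.mp hw
    have ha := (hβ.pos e he0).ne'
    by_cases hz0 : z = 0
    · subst hz0
      rw [add_zero] at hw0 hw ⊢
      have hc : c ≠ 0 := by rintro rfl; simp at hw0
      refine ⟨l, isOrthoList_cons.mpr ⟨⟨hw0, fun y hy => by simp [he y hy]⟩, hl'⟩, ?_, ?_⟩
      · rw [listSpan_cons, listSpan_cons, Submodule.span_singleton_smul_eq (IsUnit.mk0 c hc)]
      · have := sameClass_cons_sq_mul (p := p) (L := norms β l) hp2 ha hc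
          (norms_prod_ne_zero hβ hl')
        simpa [norms, sq, mul_assoc] using this
    · obtain ⟨m, hm, hspan, hcls⟩ := ih hl' z hz hz0
      obtain ⟨⟨-, hzm⟩, hm'⟩ := isOrthoList_cons.mp hm
      have hb := hβ.pos z hz0
      have hem : ∀ y ∈ listSpan l, β e y = 0 := fun y hy => eq_zero_of_mem_listSpan he hy
      have hez : β e z = 0 := hem z hz
      have hze : β z e = 0 := by rw [hβ.symm, hez]
      have hmem : ∀ y ∈ m, y ∈ listSpan l := fun y hy => hspan ▸ mem_listSpan (by simp [hy])
      have hs : 0 < c ^ 2 * β e e + β z z := by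
        have := hβ.pos e he0; positivity
      have hww : β (c • e + z) (c • e + z) = c ^ 2 * β e e + β z z := by
        simp [hez, hze]; ring
      -- The direction orthogonal to `c • e + z` in the plane of `e` and `z`, scaled so that its
      -- norm is exactly the second entry in `sameClass_cons_cons`.
      set g : V := β z z • e - (c * β e e) • z with hg
      have hgg : β g g = β e e * β z z * (c ^ 2 * β e e + β z z) := by
        simp [hg, hez, hze]; ring
      have hwg : β (c • e + z) g = 0 := by
        simp [hg, hez, hze]; ring
      have hg0 : g ≠ 0 := by
        intro h0
        have : β e e * β z z * (c ^ 2 * β e e + β z z) = 0 := by rw [← hgg, h0]; simp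
        exact absurd this (mul_ne_zero (mul_ne_zero ha hb.ne') hs.ne')
      refine ⟨g :: m, isOrthoList_cons.mpr ⟨⟨hw0, ?_⟩, isOrthoList_cons.mpr ⟨⟨hg0, ?_⟩, hm'⟩⟩,
        ?_, ?_⟩
      · intro y hy
        rcases List.mem_cons.mp hy with rfl | hy
        · exact hwg
        · simp [hem y (hmem y hy), hzm y hy]
      · intro y hy
        simp [hg, hem y (hmem y hy), hzm y hy]
      · rw [listSpan_cons e l, ← hspan, ← listSpan_cons]
        apply le_antisymm
        · rw [listSpan_le]
          have h1 : e ∈ listSpan (e :: z :: m) := mem_listSpan (by simp)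
          have h2 : z ∈ listSpan (e :: z :: m) := mem_listSpan (by simp)
          intro y hy
          simp only [List.mem_cons] at hy
          rcases hy with rfl | rfl | hy
          · exact add_mem (Submodule.smul_mem _ _ h1) h2
          · exact sub_mem (Submodule.smul_mem _ _ h1) (Submodule.smul_mem _ _ h2)
          · exact mem_listSpan (by simp [hy])
        · rw [listSpan_le]
          have h1 : c • e + z ∈ listSpan ((c • e + z) :: g :: m) := mem_listSpan (by simp)
          have h2 : g ∈ listSpan ((c • e + z) :: g :: m) := mem_listSpan (by simp)
          have h3 : e ∈ listSpan ((c • e + z) :: g :: m) := by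
            have : e = (c ^ 2 * β e e + β z z)⁻¹ • (g + (c * β e e) • (c • e + z)) := by
              rw [hg, eq_inv_smul_iff₀ hs.ne']
              module
            have h3 := Submodule.smul_mem _ (c ^ 2 * β e e + β z z)⁻¹
              (add_mem h2 (Submodule.smul_mem _ (c * β e e) h1))
            rwa [← this] at h3
          intro y hy
          simp only [List.mem_cons] at hy
          rcases hy with rfl | rfl | hy
          · exact h3
          · have := sub_mem h1 (Submodule.smul_mem _ c h3)
            simpa using this
          · exact mem_listSpan (by simp [hy])
      · refine (hcls.cons hp2 ha (norms_prod_ne_zero hβ hl')).trans ?_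
        have := sameClass_cons_cons (p := p) (L := norms β m) hp2 ha hb.ne' hs.ne'
          (norms_prod_ne_zero hβ hm')
        rw [← hww] at this
        simp only [norms, List.map_cons] at this ⊢
        rw [hgg, ← hww]
        exact this

/-- Pairing with `w` reads off the coefficient of `w`, which is zero for members of the other tail.
This cancels a common first vector in the induction for invariance. -/
theorem listSpan_le_of_cons_le (hβ : IsPosDefForm β) {w : V} {l m : List V}
    (hl : IsOrthoList β (w :: l)) (hm : IsOrthoList β (w :: m))
    (h : listSpan (w :: l) ≤ listSpan (w :: m)) : listSpan l ≤ listSpan m := by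
  rw [listSpan_le]
  intro x hx
  obtain ⟨c, z, hz, rfl⟩ := mem_listSpan_cons.mp (h (mem_listSpan (List.mem_cons_of_mem _ hx)))
  have h1 := (isOrthoList_cons.mp hl).1.2 _ hx
  have h2 := eq_zero_of_mem_listSpan (isOrthoList_cons.mp hm).1.2 hz
  have h3 := (hβ.pos w (isOrthoList_cons.mp hl).1.1).ne'
  simp only [map_add, map_smul, smul_eq_mul, h2, add_zero, mul_eq_zero, h3, or_false] at h1
  simpa [h1] using hz

/-- The Hasse invariant and the discriminant do not depend on the orthogonal basis. -/
theorem sameClass_of_listSpan_eq (hp2 : p ≠ 2) (hβ : IsPosDefForm β) {l m : List V}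
    (hl : IsOrthoList β l) (hm : IsOrthoList β m) (h : listSpan l = listSpan m) :
    SameClass p (norms β l) (norms β m) := by
  induction m generalizing l with
  | nil =>
    have : l = [] := by
      rw [List.eq_nil_iff_forall_not_mem]
      intro x hx
      have h1 := mem_listSpan hx
      rw [h] at h1
      exact hl.ne_zero x hx (by simpa [listSpan] using h1)
    subst this
    exact SameClass.refl _
  | cons w m ih =>
    obtain ⟨⟨hw0, hw⟩, hm'⟩ := isOrthoList_cons.mp hm
    obtain ⟨l', hl', hspan, hcls⟩ := exists_isOrthoList_cons hp2 hβ l hl w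
      (h ▸ mem_listSpan (by simp)) hw0
    refine hcls.trans ?_
    have h1 := ih (isOrthoList_cons.mp hl').2 hm' (le_antisymm
      (listSpan_le_of_cons_le hβ hl' hm (hspan.trans h).le)
      (listSpan_le_of_cons_le hβ hm hl' (hspan.trans h).ge))
    exact h1.cons hp2 (hβ.pos w hw0).ne' (norms_prod_ne_zero hβ (isOrthoList_cons.mp hl').2)

theorem finrank_listSpan (hβ : IsPosDefForm β) {l : List V} (hl : IsOrthoList β l) :
    Module.finrank ℚ (listSpan l) = l.length := by
  have h1 : LinearIndependent ℚ l.get := by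
    refine LinearMap.BilinForm.linearIndependent_of_iIsOrtho (B := β) ?_ ?_
    · intro i j hij
      have := List.pairwise_iff_get.mp hl.ortho
      rcases lt_or_gt_of_ne hij with h | h
      · exact this i j h
      · change β _ _ = 0
        rw [hβ.symm]; exact this j i h
    · intro i h
      exact (hβ.pos _ (hl.ne_zero _ (List.get_mem l i))).ne' h
  have h2 := finrank_span_eq_card h1
  rw [Fintype.card_fin] at h2
  rw [← h2, listSpan]
  have : {x | x ∈ l} = Set.range l.get := by
    ext x
    simp [List.mem_iff_get]
  rw [this]

theorem listSpan_eq_top [FiniteDimensional ℚ V] (hβ : IsPosDefForm β) {l : List V}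
    (hl : IsOrthoList β l) (h : l.length = Module.finrank ℚ V) : listSpan l = ⊤ :=
  Submodule.eq_top_of_finrank_eq (by rw [finrank_listSpan hβ hl, h])

end OrthogonalLists

end PairCovering

namespace PairCovering

/-! ### Gram–Schmidt and leading principal minors. -/

section GramSchmidt

variable {V : Type*} [AddCommGroup V] [Module ℚ V]

/-- Gram-Schmidt orthogonalisation of a sequence of vectors, without normalisation. -/
noncomputable def orthogonalize (β : LinearMap.BilinForm ℚ V) (b : ℕ → V) : ℕ → V
  | r => b r - ∑ j : Fin r, (β (b r) (orthogonalize β b j) /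
      β (orthogonalize β b j) (orthogonalize β b j)) • orthogonalize β b j
  decreasing_by exact j.2

variable {β : LinearMap.BilinForm ℚ V} (b : ℕ → V)

/-- The coefficients of a sequence of vectors with respect to its orthogonalisation. -/
noncomputable def orthoCoeff (β : LinearMap.BilinForm ℚ V) (b : ℕ → V) (r j : ℕ) : ℚ :=
  if j < r then β (b r) (orthogonalize β b j) /
    β (orthogonalize β b j) (orthogonalize β b j) else if j = r then 1 else 0

theorem orthogonalize_eq (r : ℕ) :
    orthogonalize β b r = b r - ∑ j ∈ Finset.range r, orthoCoeff β b r j • orthogonalize β b j := by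
  rw [orthogonalize, Finset.sum_range]
  congr 1
  refine Finset.sum_congr rfl fun j _ => ?_
  rw [orthoCoeff, if_pos j.2]

theorem eq_sum_orthoCoeff {r m : ℕ} (h : r < m) :
    b r = ∑ j ∈ Finset.range m, orthoCoeff β b r j • orthogonalize β b j := by
  have h1 : b r = ∑ j ∈ Finset.range (r + 1), orthoCoeff β b r j • orthogonalize β b j := by
    rw [Finset.sum_range_succ]
    have := orthogonalize_eq (β := β) b r
    rw [show orthoCoeff β b r r = 1 by simp [orthoCoeff], one_smul]
    exact (sub_eq_iff_eq_add'.mp this.symm)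
  rw [h1]
  refine Finset.sum_subset (Finset.range_mono h) fun j _ hj => ?_
  rw [Finset.mem_range, not_lt] at hj
  rw [orthoCoeff, if_neg (by omega), if_neg (by omega), zero_smul]

theorem orthogonalize_ortho (hβ : IsPosDefForm β) (r : ℕ) :
    ∀ j < r, β (orthogonalize β b r) (orthogonalize β b j) = 0 := by
  induction r using Nat.strong_induction_on with
  | _ r ih =>
    intro j hj
    have h1 : ∀ i ∈ Finset.range r, i ≠ j →
        orthoCoeff β b r i * β (orthogonalize β b i) (orthogonalize β b j) = 0 := by
      intro i hi hij
      rcases lt_or_gt_of_ne hij with h | h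
      · rw [hβ.symm, ih j hj i h, mul_zero]
      · rw [ih i (Finset.mem_range.mp hi) j h, mul_zero]
    rw [orthogonalize_eq b r]
    simp only [map_sub, map_sum, map_smul, LinearMap.sub_apply, LinearMap.sum_apply,
      LinearMap.smul_apply, smul_eq_mul]
    rw [Finset.sum_eq_single_of_mem j (Finset.mem_range.mpr hj) h1, orthoCoeff, if_pos hj]
    by_cases h0 : orthogonalize β b j = 0
    · simp [h0]
    · have := (hβ.pos _ h0).ne'
      field_simp
      ring

theorem orthogonalize_mem (r : ℕ) :
    orthogonalize β b r ∈ Submodule.span ℚ (b '' Set.Iic r) := by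
  induction r using Nat.strong_induction_on with
  | _ r ih =>
    rw [orthogonalize_eq b r]
    refine sub_mem (Submodule.subset_span ⟨r, by simp, rfl⟩) (sum_mem fun j hj => ?_)
    refine Submodule.smul_mem _ _ (Submodule.span_mono (Set.image_mono ?_)
      (ih j (Finset.mem_range.mp hj)))
    exact Set.Iic_subset_Iic.mpr (Finset.mem_range.mp hj).le

theorem orthogonalize_ne_zero {r : ℕ} (h : b r ∉ Submodule.span ℚ (b '' Set.Iio r)) :
    orthogonalize β b r ≠ 0 := by
  intro h0
  apply h
  rw [sub_eq_zero.mp ((orthogonalize_eq (β := β) b r).symm.trans h0)]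
  refine sum_mem fun j hj => Submodule.smul_mem _ _ (Submodule.span_mono (Set.image_mono ?_)
    (orthogonalize_mem b j))
  intro i hi
  exact lt_of_le_of_lt hi (Finset.mem_range.mp hj)

/-- The Gram matrix factors as `C * D * Cᵀ` with `C` unitriangular and `D` the diagonal matrix of
the orthogonalised norms. -/
theorem det_gram_eq_prod (hβ : IsPosDefForm β) (m : ℕ) :
    (Matrix.of fun i j : Fin m => β (b i) (b j)).det =
      ∏ j ∈ Finset.range m, β (orthogonalize β b j) (orthogonalize β b j) := by
  set C : Matrix (Fin m) (Fin m) ℚ := Matrix.of fun i j => orthoCoeff β b i j with hC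
  set q : Fin m → ℚ := fun j => β (orthogonalize β b j) (orthogonalize β b j) with hq
  have hdet : C.det = 1 := by
    rw [Matrix.det_of_isLowerTriangular C]
    · simp [hC, orthoCoeff]
    · intro i j hij
      have hij' : i < j := hij
      have h1 : ¬ (j : ℕ) < i := by have := Fin.lt_def.mp hij'; omega
      have h2 : ¬ (j : ℕ) = i := by have := Fin.lt_def.mp hij'; omega
      rw [hC, Matrix.of_apply, orthoCoeff, if_neg h1, if_neg h2]
  have hfac : (Matrix.of fun i j : Fin m => β (b i) (b j)) = C * Matrix.diagonal q * C.transpose := by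
    ext i j
    rw [Matrix.of_apply, Matrix.mul_apply]
    simp only [Matrix.mul_diagonal, Matrix.transpose_apply]
    conv_lhs => rw [eq_sum_orthoCoeff (β := β) b i.2, eq_sum_orthoCoeff (β := β) b j.2]
    simp only [map_sum, map_smul, LinearMap.sum_apply, LinearMap.smul_apply, smul_eq_mul]
    rw [Finset.sum_range]
    refine Finset.sum_congr rfl fun x _ => ?_
    rw [Finset.sum_eq_single_of_mem (x : ℕ) (Finset.mem_range.mpr x.2)]
    · simp only [hC, hq, Matrix.of_apply]; ring
    · intro y _ hyx
      rcases lt_or_gt_of_ne hyx with h | h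
      · rw [hβ.symm, orthogonalize_ortho b hβ x y h, mul_zero]
      · rw [orthogonalize_ortho b hβ y x h, mul_zero]
  rw [hfac, Matrix.det_mul, Matrix.det_mul, Matrix.det_transpose, hdet, Matrix.det_diagonal,
    Finset.prod_range]
  simp [hq]

variable {p : ℕ} [Fact p.Prime]

theorem prod_map_range (q : ℕ → ℚ) (m : ℕ) :
    ((List.range m).map q).prod = ∏ j ∈ Finset.range m, q j := by
  induction m with
  | zero => simp
  | succ m ih => rw [List.range_succ, List.map_append, List.prod_append, ih,
      Finset.prod_range_succ]; simp

theorem hasse_singleton (hp2 : p ≠ 2) {a : ℚ} (ha : a ≠ 0) : hasse p [a] = 1 := by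
  simp [hasse, ratHilbert_one_right hp2 ha]

/-- As `d (i + 1) = d i * q i` and `(d, -d) = 1`, the factor `(d i, -d (i + 1))` equals `(d i, q
i)`, the contribution of appending `q i`. The index 0 may be omitted because `d 0 = 1`. -/
theorem hasse_map_range (hp2 : p ≠ 2) (q d : ℕ → ℚ) (m : ℕ) (hq : ∀ i < m, q i ≠ 0)
    (hd : ∀ i ≤ m, d i = ∏ j ∈ Finset.range i, q j) :
    hasse p ((List.range m).map q) =
      ∏ i ∈ Finset.Ico 1 m, ratHilbert p (d i) (-d (i + 1)) := by
  induction m with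
  | zero => simp [hasse]
  | succ m ih =>
    have hqm := hq m (by omega)
    have hdm : d m ≠ 0 := by
      rw [hd m (by omega)]
      exact Finset.prod_ne_zero_iff.mpr fun i hi => hq i (by have := Finset.mem_range.mp hi; omega)
    rw [List.range_succ, List.map_append, List.map_singleton, hasse_append hp2 _ (by simpa using hqm),
      hasse_singleton hp2 hqm, mul_one, ih (fun i hi => hq i (by omega)) (fun i hi => hd i (by omega))]
    · have hprod : ((List.range m).map q).prod = d m := by
        rw [hd m (by omega)]
        exact prod_map_range q m
      rw [hprod, List.prod_singleton]
      rcases Nat.eq_zero_or_pos m with rfl | hm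
      · have : d 0 = 1 := by rw [hd 0 (by omega)]; simp
        simp [this, ratHilbert_one_left hp2 hqm]
      · rw [Finset.prod_Ico_succ_top hm]
        congr 1
        rw [hd (m + 1) le_rfl, Finset.prod_range_succ, ← hd m (by omega),
          ← neg_mul, ratHilbert_mul_right hp2 (neg_ne_zero.mpr hdm) hqm hdm,
          ratHilbert_neg_self hp2 hdm, one_mul]
    · intro a ha
      obtain ⟨i, hi, rfl⟩ := List.mem_map.mp ha
      exact hq i (by have := List.mem_range.mp hi; omega)

/-- The Hasse-Minkowski invariant of the Gram matrix of a basis, in terms of an orthogonal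
basis. -/
theorem exists_isOrthoList_hasseMinkowski (hp2 : p ≠ 2) (hβ : IsPosDefForm β) {m : ℕ}
    (X : Matrix (Fin m) (Fin m) ℤ) (v : Fin m → V) (hv : LinearIndependent ℚ v)
    (hX : ∀ i j, (X i j : ℚ) = β (v i) (v j)) :
    Nondegenerate X ∧ ∃ l, IsOrthoList β l ∧ l.length = m ∧
      hasseMinkowski p X = ratHilbert p (-1) (-(norms β l).prod) * hasse p (norms β l) := by
  -- Padding by zero beyond `m` is harmless: only indices below `m` are used.
  set b : ℕ → V := fun r => if h : r < m then v ⟨r, h⟩ else 0 with hb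
  set q : ℕ → ℚ := fun j => β (orthogonalize β b j) (orthogonalize β b j) with hq
  have hne : ∀ r < m, orthogonalize β b r ≠ 0 := by
    intro r hr
    refine orthogonalize_ne_zero b ?_
    have h1 := hv.notMem_span_image (s := Set.Iio ⟨r, hr⟩) (x := ⟨r, hr⟩) (by simp)
    have h2 : b '' Set.Iio r = v '' Set.Iio ⟨r, hr⟩ := by
      ext x
      constructor
      · rintro ⟨j, hj, rfl⟩
        have hj' : j < r := hj
        exact ⟨⟨j, hj'.trans hr⟩, hj', by simp [hb, hj'.trans hr]⟩
      · rintro ⟨j, hj, rfl⟩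
        exact ⟨j, hj, by simp [hb]⟩
    rw [h2]
    simpa [hb, hr] using h1
  have hq0 : ∀ r < m, q r ≠ 0 := fun r hr => (hβ.pos _ (hne r hr)).ne'
  have hd : ∀ i ≤ m, (leadingMinor X i : ℚ) = ∏ j ∈ Finset.range i, q j := by
    intro i hi
    rw [← det_gram_eq_prod b hβ i, leadingMinor, dif_pos hi]
    refine (RingHom.map_det (Int.castRingHom ℚ) _).trans ?_
    congr 1
    ext x y
    have hx : (x : ℕ) < m := x.2.trans_le hi
    have hy : (y : ℕ) < m := y.2.trans_le hi
    simp only [RingHom.mapMatrix_apply, Matrix.map_apply, Matrix.submatrix_apply,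
      Int.coe_castRingHom, hX, Matrix.of_apply, hb, hx, hy, dif_pos]
    rfl
  refine ⟨?_, (List.range m).map (orthogonalize β b), ⟨?_, ?_⟩, by simp, ?_⟩
  · intro i _ hi h0
    have := hd i hi
    rw [h0, Int.cast_zero] at this
    exact Finset.prod_ne_zero_iff.mpr
      (fun j hj => hq0 j ((Finset.mem_range.mp hj).trans_le hi)) this.symm
  · rw [List.pairwise_map]
    exact List.pairwise_lt_range.imp fun {i j} h => by
      rw [hβ.symm]; exact orthogonalize_ortho b hβ _ _ h
  · intro x hx
    obtain ⟨i, hi, rfl⟩ := List.mem_map.mp hx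
    exact hne i (List.mem_range.mp hi)
  · have hnorms : norms β ((List.range m).map (orthogonalize β b)) = (List.range m).map q := by
      simp [norms, hq]
    have hprod : ((List.range m).map q).prod = leadingMinor X m := by
      rw [hd m le_rfl]
      exact prod_map_range q m
    rw [hnorms, hasse_map_range hp2 q (fun i => leadingMinor X i) m hq0 hd, hprod, hasseMinkowski]
    congr 1
    · rw [← ratHilbert_intCast]; push_cast; rfl
    · refine Finset.prod_congr rfl fun i _ => ?_
      rw [← ratHilbert_intCast]; push_cast; rfl

end GramSchmidt

end PairCovering

namespace PairCovering

/-! ### Lucas numbers and their `p`-adic behaviour when `p ∣ y`. -/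

section LucasSequence

/-- The Lucas sequence `0, 1, 2 - y, …` with recursion `S (m + 2) = (2 - y) S (m + 1) - S m`. -/
def lucas (y : ℤ) : ℕ → ℤ
  | 0 => 0
  | 1 => 1
  | m + 2 => (2 - y) * lucas y (m + 1) - lucas y m

theorem lucas_add_two (y : ℤ) (m : ℕ) :
    lucas y (m + 2) = (2 - y) * lucas y (m + 1) - lucas y m := by rw [lucas]

/-- The quadratic invariant of the recursion; equivalently S_{m+1}² - S_m S_{m+2} = 1. -/
theorem lucas_sq (y : ℤ) (m : ℕ) :
    lucas y (m + 1) ^ 2 - (2 - y) * lucas y m * lucas y (m + 1) + lucas y m ^ 2 = 1 := by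
  induction m with
  | zero => simp [lucas]
  | succ m ih => rw [lucas_add_two]; linear_combination ih

theorem lucas_add (y : ℤ) (a b : ℕ) :
    lucas y (a + b + 1) = lucas y (a + 1) * lucas y (b + 1) - lucas y a * lucas y b := by
  induction b using Nat.strong_induction_on with
  | _ b ih =>
    match b with
    | 0 => simp [lucas]
    | 1 => rw [lucas_add_two]; simp [lucas]; ring
    | b + 2 =>
      have h1 := ih (b + 1) (by omega)
      have h2 := ih b (by omega)
      rw [show a + (b + 2) + 1 = a + b + 1 + 2 by ring, lucas_add_two y (a + b + 1),
        show b + 2 + 1 = b + 1 + 2 by ring, lucas_add_two y (b + 1), lucas_add_two y b, h2,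
        show a + b + 1 + 1 = a + (b + 1) + 1 by ring, h1, lucas_add_two]
      ring

/-- For a root w of x² - (2 - y)x + 1 the left side is 2 - w^N - w^(-N) with N = 2m + 1. For odd N
it is `y` times a square, which fixes the square class of the last norm of a cycle. -/
theorem two_sub_lucas_sub (y : ℤ) (m : ℕ) :
    2 - (lucas y (2 * m + 2) - lucas y (2 * m)) = y * (lucas y (m + 1) + lucas y m) ^ 2 := by
  have h1 := lucas_add y m m
  have h2 := lucas_add y (m + 1) m
  have h3 := lucas_add_two y (2 * m)
  rw [← two_mul] at h1
  rw [show m + 1 + m + 1 = 2 * m + 2 by ring] at h2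
  linear_combination (-2) * h2 + h3 - 2 * lucas_sq y m + (2 - y) * h1
    - 2 * lucas y (m + 1) * lucas_add_two y m

/-- The multiplier `2 - y` is at most -3, so signs alternate and absolute values never decrease;
hence no term after the first vanishes. -/
theorem lucas_sign {y : ℤ} (hy : 5 ≤ y) (m : ℕ) :
    1 ≤ (-1) ^ m * lucas y (m + 1) ∧
      (-1) ^ m * lucas y (m + 1) ≤ (-1) ^ (m + 1) * lucas y (m + 2) := by
  induction m with
  | zero => simp [lucas]; linarith
  | succ m ih =>
    refine ⟨ih.1.trans ih.2, ?_⟩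
    have h := lucas_add_two y (m + 1)
    have h2 : (-1 : ℤ) ^ (m + 1 + 1) * lucas y (m + 1 + 2) =
        (y - 2) * ((-1) ^ (m + 1) * lucas y (m + 2)) - (-1) ^ m * lucas y (m + 1) := by
      rw [h]; ring
    rw [h2]
    nlinarith [ih.1, ih.2]

theorem lucas_ne_zero {y : ℤ} (hy : 5 ≤ y) {m : ℕ} (hm : m ≠ 0) : lucas y m ≠ 0 := by
  obtain ⟨m, rfl⟩ := Nat.exists_eq_succ_of_ne_zero hm
  intro h
  have := (lucas_sign hy m).1
  rw [h] at this
  simp at this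

theorem dvd_lucas_sub {y q : ℤ} (hq : q ∣ y) (m : ℕ) : q ∣ lucas y m - m := by
  induction m using Nat.strong_induction_on with
  | _ m ih =>
    match m with
    | 0 => simp [lucas]
    | 1 => simp [lucas]
    | m + 2 =>
      have h1 := ih (m + 1) (by omega)
      have h2 := ih m (by omega)
      have : lucas y (m + 2) - ((m + 2 : ℕ) : ℤ) =
          2 * (lucas y (m + 1) - ((m + 1 : ℕ) : ℤ)) - (lucas y m - m) - y * lucas y (m + 1) := by
        rw [lucas_add_two]; push_cast; ring
      rw [this]
      exact dvd_sub (dvd_sub (h1.mul_left _) h2) (hq.mul_right _)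

/-- Binet's formula; `5 ≤ y` makes the discriminant `y * (y - 4)` positive, so the root `w` is real.
-/
theorem exists_lucas_eq_div {y : ℤ} (hy : 5 ≤ y) : ∃ w : ℝ, w ≠ 0 ∧ w - w⁻¹ ≠ 0 ∧
    (w - w⁻¹) ^ 2 = y * (y - 4) ∧ ∀ m, (lucas y m : ℝ) = (w ^ m - (w ^ m)⁻¹) / (w - w⁻¹) := by
  have hy' : (5 : ℝ) ≤ y := by exact_mod_cast hy
  set d := Real.sqrt (y * (y - 4)) with hd
  have hd2 : d ^ 2 = y * (y - 4) := Real.sq_sqrt (by nlinarith)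
  have hd0 : d ≠ 0 := by
    intro h
    rw [h] at hd2
    nlinarith
  set w : ℝ := ((2 - y) + d) / 2 with hw
  have hmul : w * (((2 - y) - d) / 2) = 1 := by rw [hw]; linear_combination (-1 / 4) * hd2
  have hw0 : w ≠ 0 := left_ne_zero_of_mul_eq_one hmul
  have hinv : w⁻¹ = ((2 - y) - d) / 2 := inv_eq_of_mul_eq_one_right hmul
  have hD : w - w⁻¹ = d := by rw [hinv, hw]; ring
  have hS : w + w⁻¹ = 2 - y := by rw [hinv, hw]; ring
  refine ⟨w, hw0, by rw [hD]; exact hd0, by rw [hD]; exact hd2, fun m => ?_⟩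
  rw [hD]
  induction m using Nat.strong_induction_on with
  | _ m ih =>
    match m with
    | 0 => simp [lucas]
    | 1 => rw [pow_one, hD]; simp [lucas, hd0]
    | m + 2 =>
      rw [lucas_add_two]
      push_cast
      rw [ih (m + 1) (by omega), ih m (by omega), ← hS]
      field_simp
      ring

/-- By Binet, S_{(2j+3)m} - S_{(2j+1)m} = S_m (w^(2(j+1)m) + w^(-2(j+1)m)), and the bracket is 2 +
y(y - 4) S_{(j+1)m}². The differences are then summed. -/
theorem lucas_odd_mul {y : ℤ} (hy : 5 ≤ y) (m j : ℕ) :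
    lucas y ((2 * j + 1) * m) =
      lucas y m * (2 * j + 1 + y * (y - 4) * ∑ i ∈ Finset.range j, lucas y (m * (i + 1)) ^ 2) := by
  induction j with
  | zero => simp
  | succ j ih =>
    have key : lucas y ((2 * (j + 1) + 1) * m) - lucas y ((2 * j + 1) * m) =
        lucas y m * (2 + y * (y - 4) * lucas y (m * (j + 1)) ^ 2) := by
      obtain ⟨w, hw, hD, hD2, h⟩ := exists_lucas_eq_div hy
      have h1 : w ^ ((2 * (j + 1) + 1) * m) = (w ^ (m * (j + 1))) ^ 2 * w ^ m := by
        rw [← pow_mul, ← pow_add]; ring_nf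
      have h2 : w ^ ((2 * j + 1) * m) = (w ^ (m * (j + 1))) ^ 2 * (w ^ m)⁻¹ := by
        rw [eq_mul_inv_iff_mul_eq₀ (pow_ne_zero _ hw), ← pow_mul, ← pow_add]; ring_nf
      have : (lucas y ((2 * (j + 1) + 1) * m) : ℝ) - lucas y ((2 * j + 1) * m) =
          lucas y m * (2 + y * (y - 4) * (lucas y (m * (j + 1)) : ℝ) ^ 2) := by
        rw [h, h, h m, h (m * (j + 1)), h1, h2, ← hD2]
        have hu : w ^ m ≠ 0 := pow_ne_zero _ hw
        have hA : w ^ (m * (j + 1)) ≠ 0 := pow_ne_zero _ hw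
        generalize w ^ m = u at hu ⊢
        generalize w ^ (m * (j + 1)) = A at hA ⊢
        generalize w - w⁻¹ = D at hD ⊢
        field_simp
        ring
      exact_mod_cast this
    rw [Finset.sum_range_succ]
    push_cast
    linear_combination key + ih

variable {p : ℕ} [Fact p.Prime]

/-- With 2j + 1 = p in `lucas_odd_mul`, what is needed is p² ∣ yσ for the sum of squares σ. For p >
3 one factor comes from `y` and the other from σ, congruent to m²(1² + … + j²), since 6(1² + … + j²)
= j(j + 1)p. For p = 3 division by 6 fails, and 9 ∣ y supplies both factors. -/
theorem exists_lucas_prime_mul (hp2 : p ≠ 2) {y : ℤ} (hy : 5 ≤ y) (hpy : (p : ℤ) ∣ y)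
    (hp3 : p = 3 → 9 ∣ y) (m : ℕ) :
    ∃ z : ℤ, lucas y (m * p) = lucas y m * (p * (1 + p * z)) := by
  have hp : Prime (p : ℤ) := Nat.prime_iff_prime_int.mp Fact.out
  obtain ⟨j, hj⟩ := (Fact.out : p.Prime).odd_of_ne_two hp2
  have h := lucas_odd_mul hy m j
  rw [← hj, mul_comm p m] at h
  set σ := ∑ i ∈ Finset.range j, lucas y (m * (i + 1)) ^ 2 with hσ
  have hdvd : (p : ℤ) * p ∣ y * σ := by
    by_cases h3 : p = 3
    · subst h3; exact (hp3 rfl).mul_right _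
    · refine mul_dvd_mul hpy ?_
      have h1 : (p : ℤ) ∣ σ - ∑ i ∈ Finset.range j, ((m : ℤ) * (i + 1)) ^ 2 := by
        rw [hσ, ← Finset.sum_sub_distrib]
        refine Finset.dvd_sum fun i _ => ?_
        have := dvd_lucas_sub hpy (m * (i + 1))
        push_cast at this
        exact this.trans (sub_dvd_pow_sub_pow _ _ 2)
      have h2 : ∀ j : ℕ, 6 * ∑ i ∈ Finset.range j, ((m : ℤ) * (i + 1)) ^ 2 =
          (m : ℤ) ^ 2 * ((j : ℤ) * (j + 1) * (2 * j + 1)) := by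
        intro j
        induction j with
        | zero => simp
        | succ j ih => rw [Finset.sum_range_succ, mul_add, ih]; push_cast; ring
      have h4 : (p : ℤ) ∣ 6 * ∑ i ∈ Finset.range j, ((m : ℤ) * (i + 1)) ^ 2 := by
        rw [h2 j, show (2 * (j : ℤ) + 1) = p by rw [hj]; push_cast; ring]
        exact ((dvd_refl _).mul_left _).mul_left _
      have h6 : ¬ (p : ℤ) ∣ 6 := by
        intro h6
        have h6' : p ∣ 2 * 3 := by exact_mod_cast h6
        rcases (Fact.out : p.Prime).dvd_mul.mp h6' with h' | h'
        · exact hp2 ((Nat.prime_dvd_prime_iff_eq Fact.out Nat.prime_two).mp h')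
        · exact h3 ((Nat.prime_dvd_prime_iff_eq Fact.out Nat.prime_three).mp h')
      exact (dvd_sub_left ((hp.dvd_or_dvd h4).resolve_left h6)).mp h1
  obtain ⟨z, hz⟩ := hdvd
  refine ⟨(y - 4) * z, ?_⟩
  rw [h]
  have : (p : ℤ) = 2 * j + 1 := by rw [hj]; push_cast; ring
  rw [← this]
  linear_combination lucas y m * (y - 4) * hz

theorem exists_lucas_mul_pow (hp2 : p ≠ 2) {y : ℤ} (hy : 5 ≤ y) (hpy : (p : ℤ) ∣ y)
    (hp3 : p = 3 → 9 ∣ y) (m d : ℕ) :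
    ∃ u : ℤ, lucas y (m * p ^ d) = u * (p : ℤ) ^ d ∧ (p : ℤ) ∣ u - m := by
  induction d with
  | zero => exact ⟨lucas y m, by simp, dvd_lucas_sub hpy m⟩
  | succ d ih =>
    obtain ⟨u, h1, h2⟩ := ih
    obtain ⟨z, hz⟩ := exists_lucas_prime_mul hp2 hy hpy hp3 (m * p ^ d)
    refine ⟨u * (1 + p * z), ?_, ?_⟩
    · rw [pow_succ, ← mul_assoc, hz, h1]; ring
    · have : u * (1 + p * z) - m = u - m + p * (u * z) := by ring
      rw [this]
      exact dvd_add h2 (dvd_mul_right _ _)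

/-- S_n and n contain the same power of `p` and have congruent unit parts, so they lie in one
`p`-adic square class. -/
theorem hilbert_lucas (hp2 : p ≠ 2) {y : ℤ} (hy : 5 ≤ y) (hpy : (p : ℤ) ∣ y)
    (hp3 : p = 3 → 9 ∣ y) {n : ℕ} (hn : n ≠ 0) {x : ℤ} (hx : x ≠ 0) :
    hilbert p (lucas y n) x = hilbert p n x := by
  obtain ⟨d, m, hm, h⟩ := Nat.exists_eq_pow_mul_and_not_dvd hn p (Fact.out : p.Prime).ne_one
  rw [mul_comm] at h
  obtain ⟨u, h1, h2⟩ := exists_lucas_mul_pow hp2 hy hpy hp3 m d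
  obtain ⟨w, r, h3, h4⟩ := exists_eq_mul_pow (p := p) hx
  have hm' : ¬ (p : ℤ) ∣ m := by exact_mod_cast hm
  have hu : ¬ (p : ℤ) ∣ u := fun h' => hm' ((dvd_sub_right h').mp h2)
  rw [← h] at h1
  rw [hilbert_eq hp2 h1 hu h3 h4, hilbert_eq hp2 (show (n : ℤ) = m * (p : ℤ) ^ d by
    rw [h]; push_cast; ring) hm' h3 h4, legendreSym_congr h2]

/-- A factor with two unit entries is trivial. A term B divisible by `p` has unit neighbours A, C
and occurs in (A, -B)(B, -C) = (B, -AC), where -AC = 1 - B² ≡ 1 modulo `p`. The hypothesis on `m`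
prevents the end of the product from splitting such a pair. -/
theorem prod_hilbert_lucas (hp2 : p ≠ 2) {y : ℤ} (hy : 5 ≤ y) (hpy : (p : ℤ) ∣ y) (m : ℕ)
    (hm : ¬ p ∣ m + 1) : ∏ i ∈ Finset.range m, hilbert p ((-1) ^ i * lucas y (i + 1))
      (-((-1) ^ (i + 1) * lucas y (i + 2))) = 1 := by
  have hp : Prime (p : ℤ) := Nat.prime_iff_prime_int.mp Fact.out
  have hiff : ∀ i, (p : ℤ) ∣ (-1) ^ i * lucas y (i + 1) ↔ p ∣ i + 1 := by
    intro i
    have h1 := dvd_lucas_sub hpy (i + 1)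
    have h2 : (p : ℤ) ∣ (-1) ^ i * lucas y (i + 1) ↔ (p : ℤ) ∣ lucas y (i + 1) := by
      rcases neg_one_pow_eq_or ℤ i with h | h <;> simp [h]
    rw [h2, ← Int.natCast_dvd_natCast]
    exact ⟨fun h => (dvd_sub_right h).mp h1, fun h => (dvd_sub_left h).mp h1⟩
  have hne : ∀ i, (-1) ^ i * lucas y (i + 1) ≠ 0 := fun i h => by
    have := (lucas_sign hy i).1
    omega
  induction m using Nat.strong_induction_on with
  | _ m ih =>
    match m with
    | 0 => simp
    | m + 1 =>
      rw [Finset.prod_range_succ]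
      have hu : ¬ (p : ℤ) ∣ (-1) ^ (m + 1) * lucas y (m + 2) := fun h => hm ((hiff _).mp h)
      by_cases h1 : p ∣ m + 1
      · match m with
        | 0 => exact absurd h1 (by simpa using (Fact.out : p.Prime).ne_one)
        | m + 1 =>
          have h2 : ¬ p ∣ m + 1 := fun h => by
            have h3 := (Nat.dvd_add_right h).mp h1
            exact (Fact.out : p.Prime).not_dvd_one h3
          rw [Finset.prod_range_succ, ih m (by omega) h2, one_mul]
          have hv : ¬ (p : ℤ) ∣ (-1) ^ m * lucas y (m + 1) := fun h => h2 ((hiff _).mp h)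
          have hs : (p : ℤ) ∣ (-1) ^ (m + 1) * lucas y (m + 2) := (hiff _).mpr h1
          have key := lucas_sq y (m + 1)
          have hrec := lucas_add_two y (m + 1)
          set A := (-1) ^ m * lucas y (m + 1) with hA
          set B := (-1) ^ (m + 1) * lucas y (m + 2) with hB
          set C := (-1) ^ (m + 1 + 1) * lucas y (m + 1 + 2) with hC
          have hrel : -(A * C) = 1 - B * B := by
            rw [hA, hB, hC, hrec]
            have hsq : ((-1 : ℤ) ^ m) ^ 2 = 1 := by rw [← pow_mul, mul_comm, pow_mul]; simp
            rw [pow_succ, pow_succ]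
            linear_combination ((-1) ^ m) ^ 2 * key + hsq
          have hA0 : A ≠ 0 := hne m
          have hB0 : B ≠ 0 := hne (m + 1)
          have hC0 : C ≠ 0 := hne (m + 2)
          rw [show -B = -1 * B by ring, hilbert_mul_right hp2 (by norm_num) hB0 hA0,
            hilbert_eq_one_of_not_dvd hp2 hv not_dvd_neg_one, one_mul, hilbert_comm hp2 hA0 hB0,
            ← hilbert_mul_right hp2 hA0 (neg_ne_zero.mpr hC0) hB0]
          refine hilbert_eq_one_of_dvd_sub_sq hp2 hB0 (c := 1)
            (fun h => not_dvd_neg_one (dvd_neg.mpr h)) ?_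
          rw [show A * -C - 1 * 1 = B * (-B) by linear_combination hrel]
          exact hs.mul_right _
      · rw [ih m (by omega) h1, one_mul]
        refine hilbert_eq_one_of_not_dvd hp2 (fun h => h1 ((hiff _).mp h)) ?_
        rw [dvd_neg]
        exact hu

end LucasSequence

end PairCovering

namespace PairCovering

/-! ### The form of a single cycle and its sum-zero subspace. -/

section CycleForm

variable {n : ℕ}

/-- The vector with the first `r` coordinates `ψ 1, …, ψ r`. -/
def truncVec (n : ℕ) (ψ : ℕ → ℚ) (r : ℕ) : ZMod n → ℚ :=
  ∑ i ∈ Finset.range r, ψ (i + 1) • Pi.single (i : ZMod n) (1 : ℚ)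

theorem truncVec_apply (ψ : ℕ → ℚ) {r j : ℕ} (hr : r ≤ n) (hj : j < n) :
    truncVec n ψ r j = if j < r then ψ (j + 1) else 0 := by
  have h : ∀ i ∈ Finset.range r, (ψ (i + 1) • Pi.single (i : ZMod n) (1 : ℚ) : ZMod n → ℚ) j =
      if j = i then ψ (j + 1) else 0 := by
    intro i hi
    have hi' := (Finset.mem_range.mp hi).trans_le hr
    have : ((j : ZMod n) = i) ↔ j = i := by
      rw [ZMod.natCast_eq_natCast_iff', Nat.mod_eq_of_lt hi', Nat.mod_eq_of_lt hj]
    simp only [Pi.smul_apply, Pi.single_apply, this, smul_eq_mul]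
    split_ifs with h
    · rw [h, mul_one]
    · rw [mul_zero]
  rw [truncVec, Finset.sum_apply, Finset.sum_congr rfl h, Finset.sum_ite_eq]
  simp

variable [NeZero n]

/-- The bilinear form of the circulant matrix with `a` on the diagonal and `1` next to it. -/
def cycleForm (n : ℕ) [NeZero n] (a : ℚ) : LinearMap.BilinForm ℚ (ZMod n → ℚ) :=
  LinearMap.mk₂ ℚ (fun x z => ∑ i, (a * (x i * z i) + x i * z (i + 1) + x (i + 1) * z i))
    (fun x x' z => by rw [← Finset.sum_add_distrib]; congr! 1; simp only [Pi.add_apply]; ring)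
    (fun c x z => by rw [smul_eq_mul, Finset.mul_sum]; congr! 1; simp only [Pi.smul_apply, smul_eq_mul]; ring)
    (fun x z z' => by rw [← Finset.sum_add_distrib]; congr! 1; simp only [Pi.add_apply]; ring)
    (fun c x z => by rw [smul_eq_mul, Finset.mul_sum]; congr! 1; simp only [Pi.smul_apply, smul_eq_mul]; ring)

theorem cycleForm_apply (a : ℚ) (x z : ZMod n → ℚ) :
    cycleForm n a x z = ∑ i, (a * (x i * z i) + x i * z (i + 1) + x (i + 1) * z i) := rfl

theorem cycleForm_eq_sum (a : ℚ) (x z : ZMod n → ℚ) :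
    cycleForm n a x z = ∑ i, x i * (a * z i + z (i + 1) + z (i - 1)) := by
  have h : ∑ i : ZMod n, x (i + 1) * z i = ∑ i, x i * z (i - 1) := by
    rw [← Equiv.sum_comp (Equiv.addRight (1 : ZMod n)) fun i => x i * z (i - 1)]
    simp
  rw [cycleForm_apply, Finset.sum_add_distrib, h, ← Finset.sum_add_distrib]
  exact Finset.sum_congr rfl fun i _ => by ring

theorem cycleForm_single (a : ℚ) (i : ZMod n) (z : ZMod n → ℚ) :
    cycleForm n a (Pi.single i 1) z = a * z i + z (i + 1) + z (i - 1) := by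
  rw [cycleForm_eq_sum, Finset.sum_eq_single_of_mem i (Finset.mem_univ _)]
  · simp
  · intro j _ hj
    simp [hj]

theorem cycleForm_one (a : ℚ) (z : ZMod n → ℚ) :
    cycleForm n a 1 z = (a + 2) * ∑ i, z i := by
  have h1 : ∑ i : ZMod n, z (i + 1) = ∑ i, z i := Equiv.sum_comp (Equiv.addRight (1 : ZMod n)) z
  rw [cycleForm_apply]
  simp only [Pi.one_apply, one_mul, Finset.sum_add_distrib, h1, ← Finset.mul_sum]
  ring

/-- The quadratic form is the sum of (a - 2)x_i² + (x_i + x_{i+1})². -/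
theorem cycleForm_isPosDefForm {a : ℚ} (ha : 2 < a) : IsPosDefForm (cycleForm n a) where
  symm x z := by
    rw [cycleForm_apply, cycleForm_apply]
    exact Finset.sum_congr rfl fun i _ => by ring
  pos x hx := by
    have h1 : ∑ i : ZMod n, x (i + 1) ^ 2 = ∑ i, x i ^ 2 :=
      Equiv.sum_comp (Equiv.addRight (1 : ZMod n)) fun i => x i ^ 2
    have h2 : cycleForm n a x x = ∑ i, ((a - 2) * x i ^ 2 + (x i + x (i + 1)) ^ 2) := by
      have : ∑ i, ((a - 2) * x i ^ 2 + (x i + x (i + 1)) ^ 2) = cycleForm n a x x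
          + (∑ i : ZMod n, x (i + 1) ^ 2 - ∑ i, x i ^ 2) := by
        rw [cycleForm_apply, ← Finset.sum_sub_distrib, ← Finset.sum_add_distrib]
        exact Finset.sum_congr rfl fun i _ => by ring
      rw [this, h1]; ring
    rw [h2]
    obtain ⟨i, hi⟩ := Function.ne_iff.mp hx
    have ha' : 0 < a - 2 := by linarith
    refine Finset.sum_pos' (fun i _ => by positivity) ⟨i, Finset.mem_univ _, ?_⟩
    have : 0 < x i ^ 2 := by
      have : x i ≠ 0 := hi
      positivity
    positivity

/-- The circulant matrix annihilates a solution of the recursion except at the truncation and at the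
wrap-around, so only boundary terms survive. -/
theorem cycleForm_truncVec {a : ℚ} {ψ : ℕ → ℚ} (hψ : ∀ i, ψ (i + 2) = -a * ψ (i + 1) - ψ i)
    (r : ℕ) (z : ZMod n → ℚ) : cycleForm n a (truncVec n ψ r) z =
      ψ r * z r - ψ (r + 1) * z (r - 1) + ψ 1 * z (-1) - ψ 0 * z 0 := by
  induction r with
  | zero => simp [truncVec]
  | succ r ih =>
    rw [truncVec, Finset.sum_range_succ, ← truncVec, map_add, LinearMap.add_apply, ih, map_smul,
      LinearMap.smul_apply, cycleForm_single, hψ]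
    push_cast
    rw [add_sub_cancel_right, smul_eq_mul]
    ring

variable {p : ℕ} [Fact p.Prime]

/-- All vectors but the last are the Gram–Schmidt vectors of the standard basis, with norms the
ratios of consecutive leading minors. The last, `f`, pairs with a vector only through its final
coordinate, where the others vanish. -/
theorem exists_isOrthoList_cycleForm {y : ℤ} (hy : 5 ≤ y) (h : ℕ)
    (hn : n = 2 * h + 1) :
    ∃ (f : ZMod n → ℚ) (c : ℚ), c ≠ 0 ∧
      IsOrthoList (cycleForm n (y - 2)) ((List.range (2 * h)).map (fun j : ℕ =>
        (lucas y (j + 1) : ℚ)⁻¹ • truncVec _ (fun i => lucas y i) (j + 1)) ++ [f]) ∧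
      norms (cycleForm n (y - 2)) ((List.range (2 * h)).map (fun j : ℕ =>
        (lucas y (j + 1) : ℚ)⁻¹ • truncVec _ (fun i => lucas y i) (j + 1)) ++ [f]) =
      (List.range (2 * h)).map (fun j => -(lucas y (j + 2) : ℚ) / lucas y (j + 1)) ++
        [c ^ 2 * (y * lucas y (2 * h + 1))] := by
  subst hn
  set β := cycleForm (2 * h + 1) ((y : ℚ) - 2) with hβdef
  have hy' : (5 : ℚ) ≤ y := by exact_mod_cast hy
  have hβ : IsPosDefForm β := cycleForm_isPosDefForm (by linarith)
  have hS : ∀ i, (lucas y (i + 1) : ℚ) ≠ 0 := fun i => by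
    exact_mod_cast lucas_ne_zero hy (Nat.succ_ne_zero i)
  have hlast : (-1 : ZMod (2 * h + 1)) = ((2 * h : ℕ) : ZMod (2 * h + 1)) := by
    have := ZMod.natCast_self (2 * h + 1)
    push_cast at this ⊢
    linear_combination -this
  have hrec : ∀ i, (lucas y (i + 2) : ℚ) = -((y : ℚ) - 2) * lucas y (i + 1) - lucas y i := by
    intro i; rw [lucas_add_two]; push_cast; ring
  set g : ℕ → (ZMod (2 * h + 1) → ℚ) := truncVec _ (fun i => (lucas y i : ℚ)) with hg
  have hgβ : ∀ j z, β (g (j + 1)) z = lucas y (j + 1) * z ((j + 1 : ℕ) : ZMod (2 * h + 1))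
      - lucas y (j + 2) * z (j : ZMod (2 * h + 1)) + z ((2 * h : ℕ) : ZMod (2 * h + 1)) := by
    intro j z
    rw [hg, cycleForm_truncVec (fun i => hrec i) (j + 1) z, ← hlast]
    push_cast
    rw [add_sub_cancel_right]
    simp [lucas]
  have hgz : ∀ r j, r ≤ j → j < 2 * h + 1 → g r (j : ZMod (2 * h + 1)) = 0 := fun r j hr hj => by
    rw [hg, truncVec_apply _ (by omega) hj, if_neg (by omega)]
  -- A combination of S_i and S_{i-1} = (2 - y)S_i - S_{i+1}, with coefficients chosen so that `ψ (2
  -- * h + 1) = ψ 0`; this cancels the terms at coordinate 0 in `cycleForm_truncVec`.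
  set ψ : ℕ → ℚ := fun i => (lucas y (2 * h) + 1) * lucas y i
    - lucas y (2 * h + 1) * ((2 - y) * lucas y i - lucas y (i + 1)) with hψ
  set f := truncVec (2 * h + 1) ψ (2 * h + 1) with hf
  have hfβ : ∀ z, β f z = (2 - (lucas y (2 * h + 2) - lucas y (2 * h))) *
      z ((2 * h : ℕ) : ZMod (2 * h + 1)) := by
    intro z
    have hψrec : ∀ i, ψ (i + 2) = -((y : ℚ) - 2) * ψ (i + 1) - ψ i := by
      intro i
      simp only [hψ]
      rw [show i + 2 + 1 = i + 1 + 2 by ring, show i + 1 + 1 = i + 2 by ring, hrec (i + 1),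
        hrec i]
      ring
    have hsq : ((lucas y (2 * h + 1) : ℚ)) ^ 2 - (2 - y) * lucas y (2 * h) * lucas y (2 * h + 1) +
        (lucas y (2 * h) : ℚ) ^ 2 = 1 := by exact_mod_cast lucas_sq y (2 * h)
    have h0 : ψ 0 = lucas y (2 * h + 1) := by simp [hψ, lucas]
    have h1 : ψ 1 = lucas y (2 * h) + 1 := by simp [hψ, lucas]
    have h2 : ψ (2 * h + 1) = lucas y (2 * h + 1) := by
      simp only [hψ]; rw [hrec (2 * h)]; ring
    have h3 : ψ (2 * h + 1 + 1) = (lucas y (2 * h) + 1) * lucas y (2 * h + 2)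
        - (lucas y (2 * h + 1) : ℚ) ^ 2 := by
      simp only [hψ]; rw [show 2 * h + 1 + 1 + 1 = 2 * h + 1 + 2 by ring, hrec (2 * h + 1)]; ring
    rw [hf, cycleForm_truncVec hψrec, ZMod.natCast_self, zero_sub, h0, h1, h2, h3, hlast]
    rw [hrec (2 * h)]
    linear_combination (z ((2 * h : ℕ) : ZMod (2 * h + 1))) * hsq
  have hflast : f ((2 * h : ℕ) : ZMod (2 * h + 1)) = lucas y (2 * h + 1) := by
    rw [hf, truncVec_apply _ le_rfl (by omega), if_pos (by omega)]
    simp only [hψ]; rw [hrec (2 * h)]; ring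
  have hf0 : f ≠ 0 := fun h0 => hS (2 * h) (by rw [← hflast, h0]; rfl)
  have hff : β f f = (lucas y (h + 1) + lucas y h : ℚ) ^ 2 * (y * lucas y (2 * h + 1)) := by
    have : (2 - (lucas y (2 * h + 2) - lucas y (2 * h)) : ℚ) =
      y * (lucas y (h + 1) + lucas y h) ^ 2 := by exact_mod_cast two_sub_lucas_sub y h
    rw [hfβ, hflast, this]; ring
  have hgg : ∀ j < 2 * h, β (g (j + 1)) (g (j + 1)) = -(lucas y (j + 2) * lucas y (j + 1)) := by
    intro j hj
    rw [hgβ, hgz _ (j + 1) le_rfl (by omega), hgz _ (2 * h) (by omega) (by omega)]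
    rw [hg, truncVec_apply _ (by omega) (by omega), if_pos (by omega)]
    ring
  have hg0 : ∀ j < 2 * h, g (j + 1) ≠ 0 := by
    intro j hj h0
    have := hgg j hj
    rw [h0] at this
    simp only [map_zero, zero_eq_neg, mul_eq_zero] at this
    exact this.elim (hS (j + 1)) (hS j)
  refine ⟨f, lucas y (h + 1) + lucas y h, ?_, ⟨?_, ?_⟩, ?_⟩
  · intro h0
    have := hβ.pos f hf0
    rw [hff, h0] at this
    simp at this
  · rw [List.pairwise_append, List.pairwise_map]
    refine ⟨?_, by simp, ?_⟩
    · refine List.pairwise_lt_range.imp_of_mem fun {i j} hi hj hij => ?_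
      have hj' := List.mem_range.mp hj
      have : β (g (i + 1)) (g (j + 1)) = 0 := by
        rw [hβ.symm, hgβ, hgz _ _ (by omega) (by omega), hgz _ _ (by omega) (by omega),
          hgz _ _ (by omega) (by omega)]
        ring
      simp [this]
    · intro x hx z hz
      obtain ⟨j, hj, rfl⟩ := List.mem_map.mp hx
      have hj' := List.mem_range.mp hj
      rw [List.mem_singleton.mp hz, hβ.symm, map_smul, hfβ, hgz _ _ (by omega) (by omega)]
      simp
  · intro x hx
    rcases List.mem_append.mp hx with hx | hx
    · obtain ⟨j, hj, rfl⟩ := List.mem_map.mp hx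
      exact smul_ne_zero (inv_ne_zero (hS j)) (hg0 j (List.mem_range.mp hj))
    · rw [List.mem_singleton.mp hx]; exact hf0
  · rw [norms, List.map_append, List.map_map, List.map_singleton, hff]
    congr 1
    refine List.map_congr_left fun j hj => ?_
    have h1 := hS j
    simp only [Function.comp_apply, map_smul, LinearMap.smul_apply, smul_eq_mul]
    rw [hgg j (List.mem_range.mp hj)]
    field_simp

theorem ratHilbert_eq_one_of_dvd_sub_one (hp2 : p ≠ 2) {b : ℤ} (hb : (p : ℤ) ∣ b - 1) {x : ℚ}
    (hx : x ≠ 0) : ratHilbert p b x = 1 := by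
  have h1 : ¬ (p : ℤ) ∣ 1 := fun h => not_dvd_neg_one (dvd_neg.mpr h)
  have hb0 : b ≠ 0 := by rintro rfl; exact not_dvd_neg_one (by simpa using hb)
  have hb0' : (b : ℚ) ≠ 0 := by exact_mod_cast hb0
  rw [ratHilbert_comm hp2 hb0' hx]
  have := hilbert_eq_one_of_dvd_sub_sq hp2 (num_mul_den_ne_zero hx) h1 (by simpa using hb)
  simpa [ratHilbert] using this

/-- The vectors with coordinate sum zero have an orthogonal basis with trivial Hasse invariant
and discriminant `n`. -/
theorem exists_isOrthoList_one_cons (hp2 : p ≠ 2) {y : ℤ} (hy : 5 ≤ y) (hpy : (p : ℤ) ∣ y)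
    (hp3 : p = 3 → 9 ∣ y) (h : ℕ) (hn : n = 2 * h + 1) (hpn : p ∣ n) :
    ∃ l, IsOrthoList (cycleForm n (y - 2)) (1 :: l) ∧ l.length = 2 * h ∧
      hasse p (norms (cycleForm n (y - 2)) l) = 1 ∧
      ∃ c : ℚ, c ≠ 0 ∧
        (norms (cycleForm n (y - 2)) l).prod = c ^ 2 * n := by
  obtain ⟨f, c, hc, hl, hnorm⟩ := exists_isOrthoList_cycleForm hy h hn
  rw [← hn] at hnorm
  set β := cycleForm n ((y : ℚ) - 2) with hβdef
  set l := (List.range (2 * h)).map (fun j : ℕ =>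
        (lucas y (j + 1) : ℚ)⁻¹ • truncVec n (fun i => lucas y i) (j + 1)) ++ [f]
  have hy' : (5 : ℚ) ≤ y := by exact_mod_cast hy
  have hy0 : (y : ℚ) ≠ 0 := by linarith
  have hβ : IsPosDefForm β := cycleForm_isPosDefForm (by linarith)
  have hS : ∀ i, (lucas y (i + 1) : ℚ) ≠ 0 := fun i => by
    exact_mod_cast lucas_ne_zero hy (Nat.succ_ne_zero i)
  have hn0 : (n : ℚ) ≠ 0 := by rw [hn]; positivity
  have hlen : l.length = n := by simp [l, ← hn]
  have hfin : Module.finrank ℚ (ZMod n → ℚ) = n := by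
    rw [Module.finrank_fintype_fun_eq_card, ZMod.card]
  have htop : listSpan l = ⊤ := listSpan_eq_top hβ hl (by rw [hlen, hfin])
  -- The vectors orthogonal to the all-ones vector are those of sum zero; comparing the invariants
  -- of the two bases isolates that of `m`.
  obtain ⟨m, hm, hspan, hcls⟩ := exists_isOrthoList_cons (p := p) hp2 hβ l hl 1
    (by rw [htop]; trivial) one_ne_zero
  have hmlen : m.length = 2 * h := by
    have h1 := finrank_listSpan hβ hm
    rw [hspan, htop, finrank_top, hfin, List.length_cons] at h1
    omega
  have h11 : β 1 1 = y * n := by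
    rw [hβdef, cycleForm_one]; simp [ZMod.card]
  have hm1 : norms β (1 :: m) = (y * n : ℚ) :: norms β m := by
    rw [norms, List.map_cons, h11]; rfl
  obtain ⟨hcls1, d, hd, hcls2⟩ := hcls
  rw [hnorm, hm1] at hcls1 hcls2
  rcases Nat.eq_zero_or_pos h with h0 | hpos
  · exfalso
    rw [hn, h0] at hpn
    exact (Fact.out : p.Prime).not_dvd_one hpn
  -- Here `r = n - 2`. Two norms are split off because `prod_hilbert_lucas` at length `r` needs `p ∤
  -- n - 1`.
  obtain ⟨r, hr⟩ : ∃ r, 2 * h = r + 1 := ⟨2 * h - 1, by omega⟩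
  have hrn : r + 2 = n := by omega
  set q : ℕ → ℚ := fun j => -(lucas y (j + 2) : ℚ) / lucas y (j + 1) with hq
  have hq0 : ∀ j, q j ≠ 0 := fun j => div_ne_zero (neg_ne_zero.mpr (hS (j + 1))) (hS j)
  have hd' : ∀ i, (((-1) ^ i * lucas y (i + 1) : ℤ) : ℚ) = ∏ j ∈ Finset.range i, q j := by
    intro i
    induction i with
    | zero => simp [lucas]
    | succ i ih =>
      rw [Finset.prod_range_succ, ← ih, hq]
      have := hS i
      push_cast
      field_simp
      ring
  have hprn : ¬ p ∣ r + 1 := fun hdvd => by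
    have := (Nat.dvd_add_right hdvd).mp (show p ∣ r + 1 + 1 by rw [hrn]; exact hpn)
    exact (Fact.out : p.Prime).not_dvd_one this
  have hhasse : hasse p ((List.range r).map q) = 1 := by
    rw [hasse_map_range hp2 q (fun i => (((-1) ^ i * lucas y (i + 1) : ℤ) : ℚ)) r
      (fun i _ => hq0 i) (fun i _ => hd' i)]
    refine Eq.trans ?_ (prod_hilbert_lucas hp2 hy hpy r hprn)
    rcases Nat.eq_zero_or_pos r with hr0 | hr0
    · simp [hr0]
    · rw [Finset.prod_range_eq_mul_Ico _ hr0]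
      have h1 : hilbert p ((-1) ^ 0 * lucas y (0 + 1)) (-((-1) ^ (0 + 1) * lucas y (0 + 2))) = 1 := by
        rw [← ratHilbert_intCast]
        simpa [lucas] using ratHilbert_one_left (p := p) hp2 (a := (2 - y : ℚ)) (by linarith)
      rw [h1, one_mul]
      refine Finset.prod_congr rfl fun i _ => ?_
      rw [← ratHilbert_intCast]; push_cast; rfl
  have hodd : (-1 : ℤ) ^ r = -1 := Odd.neg_one_pow ⟨h - 1, by omega⟩
  have hprod : ((List.range r).map q).prod = ((-lucas y (r + 1) : ℤ) : ℚ) := by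
    rw [prod_map_range, ← hd', hodd]; simp
  -- -S_{n-1} ≡ 1 - n ≡ 1 modulo `p`, so the product of the first `n - 2` norms is a `p`-adic square
  -- and drops out.
  have hunit : (p : ℤ) ∣ -lucas y (r + 1) - 1 := by
    have h1 := dvd_lucas_sub hpy (r + 1)
    have h2 : (p : ℤ) ∣ ((r + 2 : ℕ) : ℤ) := by rw [hrn]; exact_mod_cast hpn
    have : -lucas y (r + 1) - 1 = -(lucas y (r + 1) - (r + 1 : ℕ)) - ((r + 2 : ℕ) : ℤ) := by
      push_cast; ring
    rw [this]
    exact dvd_sub (dvd_neg.mpr h1) h2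
  have hlist : (List.range (2 * h)).map q ++ [c ^ 2 * (y * lucas y n)] =
      (List.range r).map q ++ [q r, c ^ 2 * (y * lucas y n)] := by
    rw [hr, List.range_succ, List.map_append, List.append_assoc]; rfl
  have hSn : (lucas y n : ℚ) ≠ 0 := hn ▸ hS (2 * h)
  have hlast0 : c ^ 2 * (y * lucas y n) ≠ 0 := mul_ne_zero (pow_ne_zero 2 hc) (mul_ne_zero hy0 hSn)
  have hSx : ∀ x : ℤ, x ≠ 0 → ratHilbert p (lucas y n) x = ratHilbert p n x := fun x hx => by
    have := hilbert_lucas hp2 hy hpy hp3 (show n ≠ 0 by omega) hx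
    rw [← ratHilbert_intCast, ← ratHilbert_intCast] at this
    exact_mod_cast this
  have htail : [q r, c ^ 2 * (y * lucas y n)].prod ≠ 0 := by
    rw [List.prod_cons, List.prod_singleton]
    exact mul_ne_zero (hq0 r) hlast0
  have hu0 : ((-lucas y (r + 1) : ℤ) : ℚ) ≠ 0 := by
    push_cast; exact neg_ne_zero.mpr (hS r)
  have hqr : q r = ((lucas y (r + 1) : ℚ)⁻¹) ^ 2 * (((-lucas y (r + 1) : ℤ) : ℚ) * lucas y n) := by
    have := hS r
    simp only [hq]
    rw [hrn]; push_cast; field_simp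
  have hfull : hasse p ((List.range r).map q ++ [q r, c ^ 2 * (y * lucas y n)]) =
      ratHilbert p n y * ratHilbert p n n := by
    have hyn : (y : ℚ) * lucas y n ≠ 0 := mul_ne_zero hy0 hSn
    rw [hasse_append hp2 (by
        intro a ha; obtain ⟨j, -, rfl⟩ := List.mem_map.mp ha; exact hq0 j)
        htail, hhasse, hprod,
      ratHilbert_eq_one_of_dvd_sub_one hp2 hunit htail,
      hasse, hasse_singleton hp2 hlast0, List.prod_singleton,
      ratHilbert_sq_mul_right hp2 hyn (hq0 r) hc, hqr,
      ratHilbert_sq_mul_left hp2 (mul_ne_zero hu0 hSn) hyn (inv_ne_zero (hS r)),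
      ratHilbert_mul_left hp2 hu0 hSn hyn, ratHilbert_eq_one_of_dvd_sub_one hp2 hunit hyn,
      ratHilbert_mul_right hp2 hy0 hSn hSn, hSx y (by omega),
      hSx (lucas y n) (lucas_ne_zero hy (by omega)), ratHilbert_comm hp2 hn0 hSn]
    have := hSx n (by omega)
    simp only [Int.cast_natCast] at this
    rw [this]
    ring
  have hyn0 : (y : ℚ) * n ≠ 0 := mul_ne_zero hy0 hn0
  have hdisc : (norms β m).prod = (d * c * lucas y n / n) ^ 2 * n := by
    rw [hlist, List.prod_append, hprod, List.prod_cons, List.prod_cons, List.prod_singleton,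
      hqr] at hcls2
    have h1 := hS r
    refine mul_left_cancel₀ hyn0 (hcls2.trans ?_)
    push_cast
    field_simp
  have hcoef : d * c * lucas y n / n ≠ 0 :=
    div_ne_zero (mul_ne_zero (mul_ne_zero hd hc) hSn) hn0
  refine ⟨m, hm, hmlen, ?_, _, hcoef, hdisc⟩
  rw [hlist, hfull, hasse, hdisc, ratHilbert_sq_mul_right hp2 hn0 hyn0 hcoef,
    ratHilbert_mul_left hp2 hy0 hn0 hn0, ratHilbert_comm hp2 hy0 hn0] at hcls1
  have h2 := ratHilbert_mul_self (p := p) hp2 hn0 hy0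
  have h3 := ratHilbert_mul_self (p := p) hp2 hn0 hn0
  set A := ratHilbert p n y
  set B := ratHilbert p n n
  linear_combination (-A * B) * hcls1 - (hasse p (norms β m) - 1) * (B * B * h2 + h3)

end CycleForm

end PairCovering

namespace PairCovering

/-! ### The form of `t` cycles plus a multiple of the all-ones matrix. -/

section BlockForm

variable {p : ℕ} [Fact p.Prime]

/-- This is the sum-one relation for (-x) + (x + 1) = 1. -/
theorem ratHilbert_consecutive (hp2 : p ≠ 2) (x : ℕ) (hx : x ≠ 0) :
    ratHilbert p x (x + 1 : ℕ) = ratHilbert p (x + 1 : ℕ) (-1) := by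
  have hx0 : (x : ℚ) ≠ 0 := by exact_mod_cast hx
  have hx1 : ((x + 1 : ℕ) : ℚ) ≠ 0 := by exact_mod_cast Nat.succ_ne_zero x
  have h := ratHilbert_eq_one_of_add_eq_one (p := p) hp2 (neg_ne_zero.mpr hx0) hx1
    (by push_cast; ring)
  rw [← neg_one_mul, ratHilbert_mul_left hp2 (by norm_num) hx0 hx1,
    ratHilbert_comm hp2 (by norm_num) hx1] at h
  have h1 := ratHilbert_mul_self (p := p) hp2 hx1 (show (-1 : ℚ) ≠ 0 by norm_num)
  linear_combination ratHilbert p (x + 1 : ℕ) (-1) * h - ratHilbert p x (x + 1 : ℕ) * h1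

theorem prod_map_consecutive (c : ℚ) (m : ℕ) :
    ((List.range m).map fun j : ℕ => c * ((j + 1 : ℕ) * (j + 2 : ℕ) : ℚ)).prod =
      (m.factorial : ℚ) ^ 2 * (c ^ m * (m + 1 : ℕ)) := by
  induction m with
  | zero => simp
  | succ m ih =>
    rw [List.range_succ, List.map_append, List.prod_append, ih, List.map_singleton,
      List.prod_singleton, Nat.factorial_succ]
    push_cast
    ring

theorem hasse_append_singleton (hp2 : p ≠ 2) {L : List ℚ} {a : ℚ} (hL : ∀ b ∈ L, b ≠ 0)
    (ha : a ≠ 0) : hasse p (L ++ [a]) = hasse p L * ratHilbert p L.prod a := by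
  rw [hasse_append hp2 hL (by simpa using ha), hasse_singleton hp2 ha, mul_one,
    List.prod_singleton]

/-- Up to squares the first m entries multiply to c^m (m + 1), so each new entry contributes symbols
evaluated by `ratHilbert_consecutive`. The square class of c^m depends on the parity of m, hence the
induction by pairs. -/
theorem hasse_consecutive (hp2 : p ≠ 2) {c : ℚ} (hc : c ≠ 0) (e : ℕ) :
    hasse p ((List.range (2 * e)).map fun j : ℕ => c * ((j + 1 : ℕ) * (j + 2 : ℕ) : ℚ)) =
      ratHilbert p (2 * e + 1 : ℕ) (-1) * ratHilbert p c (2 * e + 1 : ℕ) *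
        ratHilbert p c (-1) ^ e := by
  have h1 : (-1 : ℚ) ≠ 0 := by norm_num
  have hnat : ∀ m : ℕ, ((m + 1 : ℕ) : ℚ) ≠ 0 := fun m => by exact_mod_cast Nat.succ_ne_zero m
  have hfact : ∀ m : ℕ, (m.factorial : ℚ) ≠ 0 := fun m => by exact_mod_cast m.factorial_ne_zero
  have hne : ∀ m : ℕ, ∀ b ∈ (List.range m).map fun j : ℕ => c * ((j + 1 : ℕ) * (j + 2 : ℕ) : ℚ),
      b ≠ 0 := by
    intro m b hb
    obtain ⟨j, -, rfl⟩ := List.mem_map.mp hb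
    exact mul_ne_zero hc (mul_ne_zero (hnat j) (hnat (j + 1)))
  induction e with
  | zero => simp [hasse, ratHilbert_one_left hp2 h1, ratHilbert_one_right hp2 hc]
  | succ e ih =>
    have hx := hnat (2 * e)
    have hy := hnat (2 * e + 1)
    have hz := hnat (2 * e + 2)
    have hxy := mul_ne_zero hx hy
    have hyz := mul_ne_zero hy hz
    have hcy := mul_ne_zero hc hy
    have e1 : ratHilbert p (c ^ (2 * e) * (2 * e + 1 : ℕ))
        (c * ((2 * e + 1 : ℕ) * (2 * e + 2 : ℕ))) = ratHilbert p c (2 * e + 1 : ℕ) *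
          ratHilbert p (2 * e + 1 : ℕ) (-1) * ratHilbert p (2 * e + 2 : ℕ) (-1) := by
      rw [mul_comm 2 e, pow_mul, mul_comm e 2,
        ratHilbert_sq_mul_left hp2 hx (mul_ne_zero hc hxy) (pow_ne_zero e hc),
        ratHilbert_mul_right hp2 hc hxy hx, ratHilbert_mul_right hp2 hx hy hx,
        ratHilbert_self hp2 hx, ratHilbert_consecutive hp2 (2 * e + 1) (by omega),
        ratHilbert_comm hp2 hx hc]
      ring
    have e2 : ratHilbert p (c ^ (2 * e + 1) * (2 * e + 1 + 1 : ℕ))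
        (c * ((2 * e + 1 + 1 : ℕ) * (2 * e + 1 + 2 : ℕ))) = ratHilbert p c (-1) *
          ratHilbert p (2 * e + 2 : ℕ) (-1) * ratHilbert p c (2 * e + 3 : ℕ) *
            ratHilbert p (2 * e + 3 : ℕ) (-1) := by
      rw [show c ^ (2 * e + 1) * ((2 * e + 1 + 1 : ℕ) : ℚ) =
          (c ^ e) ^ 2 * (c * ((2 * e + 1 + 1 : ℕ) : ℚ)) by ring,
        ratHilbert_sq_mul_left hp2 hcy (mul_ne_zero hc hyz) (pow_ne_zero e hc), ← mul_assoc,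
        ratHilbert_mul_right hp2 hcy hz hcy, ratHilbert_self hp2 hcy,
        ratHilbert_mul_left hp2 hc hy h1, ratHilbert_mul_left hp2 hc hy hz,
        ratHilbert_consecutive hp2 (2 * e + 2) (by omega)]
      ring
    rw [show 2 * (e + 1) = 2 * e + 1 + 1 by ring, List.range_succ, List.map_append,
      List.map_singleton, hasse_append_singleton hp2 (hne _)
        (mul_ne_zero hc hyz), prod_map_consecutive,
      ratHilbert_sq_mul_left hp2 (mul_ne_zero (pow_ne_zero _ hc) hy) (mul_ne_zero hc hyz)
        (hfact _), e2, List.range_succ, List.map_append,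
      List.map_singleton, hasse_append_singleton hp2 (hne _)
        (mul_ne_zero hc hxy), prod_map_consecutive,
      ratHilbert_sq_mul_left hp2 (mul_ne_zero (pow_ne_zero _ hc) hx) (mul_ne_zero hc hxy)
        (hfact _), e1, ih]
    have s1 := ratHilbert_mul_self (p := p) hp2 hx h1
    have s2 := ratHilbert_mul_self (p := p) hp2 hc hx
    have s3 := ratHilbert_mul_self (p := p) hp2 hy h1
    rw [show 2 * e + 1 + 1 + 1 = 2 * e + 3 by ring]
    rw [show 2 * e + 1 + 1 = 2 * e + 2 by ring] at s3
    generalize ratHilbert p (2 * e + 1 : ℕ) (-1) = a1 at *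
    generalize ratHilbert p c (2 * e + 1 : ℕ) = a2 at *
    generalize ratHilbert p (2 * e + 2 : ℕ) (-1) = a3 at *
    generalize ratHilbert p c (-1) = a4
    generalize ratHilbert p c (2 * e + 3 : ℕ) = a5
    generalize ratHilbert p (2 * e + 3 : ℕ) (-1) = a6
    calc _ = (a1 * a1) * (a2 * a2) * (a3 * a3) * (a6 * a5 * a4 ^ (e + 1)) := by ring
      _ = _ := by rw [s1, s2, s3]; ring

theorem prod_flatten_replicate (L : List ℚ) (t : ℕ) :
    (List.replicate t L).flatten.prod = L.prod ^ t := by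
  induction t with
  | zero => simp
  | succ t ih => rw [List.replicate_succ, List.flatten_cons, List.prod_append, ih]; ring

/-- Each pair of copies contributes (d, d) = (d, -1), and the number of pairs, e(2e + 1), has the
parity of e. -/
theorem hasse_flatten_replicate (hp2 : p ≠ 2) {L : List ℚ} (hL : ∀ a ∈ L, a ≠ 0)
    (h1 : hasse p L = 1) {c d : ℚ} (hc : c ≠ 0) (hd : d ≠ 0) (hprod : L.prod = c ^ 2 * d) (e : ℕ) :
    hasse p (List.replicate (2 * e + 1) L).flatten = ratHilbert p d (-1) ^ e := by
  have hP : L.prod ≠ 0 := by rw [hprod]; positivity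
  have step : ∀ t, hasse p (List.replicate (t + 1) L).flatten =
      hasse p (List.replicate t L).flatten * ratHilbert p d (d ^ t) := by
    intro t
    have hdt : d ^ t ≠ 0 := pow_ne_zero t hd
    rw [List.replicate_succ, List.flatten_cons, hasse_append hp2 hL (by
      rw [prod_flatten_replicate]; exact pow_ne_zero _ hP), h1, one_mul, prod_flatten_replicate,
      hprod, mul_pow, ← pow_mul, mul_comm 2 t, pow_mul,
      ratHilbert_sq_mul_left hp2 hd (by positivity) hc,
      ratHilbert_sq_mul_right hp2 hdt hd (pow_ne_zero t hc)]
  have heven : ∀ j, ratHilbert p d (d ^ (2 * j)) = 1 := fun j => by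
    rw [mul_comm, pow_mul, ratHilbert_sq_right hp2 hd (pow_ne_zero j hd)]
  induction e with
  | zero => simp [h1]
  | succ e ih =>
    rw [show 2 * (e + 1) + 1 = 2 * e + 1 + 1 + 1 by ring, step, step, ih,
      show 2 * e + 1 + 1 = 2 * (e + 1) by ring, heven, pow_succ d, mul_comm 2 e, pow_mul,
      ratHilbert_sq_mul_right hp2 hd hd (pow_ne_zero e hd), ratHilbert_self hp2 hd]
    ring

variable {n : ℕ} [NeZero n] {t : ℕ}

/-- The sum of all coordinates. -/
def total (f : Fin t → ZMod n → ℚ) : ℚ := ∑ i, ∑ j, f i j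

theorem total_add (f g : Fin t → ZMod n → ℚ) : total (f + g) = total f + total g := by
  simp [total, Finset.sum_add_distrib]

theorem total_smul (c : ℚ) (f : Fin t → ZMod n → ℚ) : total (c • f) = c * total f := by
  simp [total, Finset.mul_sum]

/-- The bilinear form of a block diagonal matrix with circulant blocks, plus `b` times the
all-ones matrix. -/
def blockForm (n : ℕ) [NeZero n] (t : ℕ) (a b : ℚ) : LinearMap.BilinForm ℚ (Fin t → ZMod n → ℚ) :=
  LinearMap.mk₂ ℚ (fun f g => ∑ i, cycleForm n a (f i) (g i) + b * (total f * total g))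
    (fun f f' g => by simp [Finset.sum_add_distrib, total_add]; ring)
    (fun c f g => by simp [← Finset.mul_sum, total_smul]; ring)
    (fun f g g' => by simp [Finset.sum_add_distrib, total_add]; ring)
    (fun c f g => by simp [← Finset.mul_sum, total_smul]; ring)

theorem blockForm_apply (a b : ℚ) (f g : Fin t → ZMod n → ℚ) :
    blockForm n t a b f g = ∑ i, cycleForm n a (f i) (g i) + b * (total f * total g) := rfl

theorem blockForm_isPosDefForm {a b : ℚ} (ha : 2 < a) (hb : 0 ≤ b) :
    IsPosDefForm (blockForm n t a b) where
  symm f g := by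
    rw [blockForm_apply, blockForm_apply, mul_comm (total f)]
    congr 1
    exact Finset.sum_congr rfl fun i _ => (cycleForm_isPosDefForm ha).symm _ _
  pos f hf := by
    have hβ := cycleForm_isPosDefForm (n := n) ha
    have hnn : ∀ x, 0 ≤ cycleForm n a x x := fun x => by
      by_cases h : x = 0
      · simp [h]
      · exact (hβ.pos x h).le
    obtain ⟨i, hi⟩ := Function.ne_iff.mp hf
    have h1 : 0 < ∑ i, cycleForm n a (f i) (f i) :=
      Finset.sum_pos' (fun i _ => hnn _) ⟨i, Finset.mem_univ _, hβ.pos _ hi⟩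
    have h2 := mul_nonneg hb (mul_self_nonneg (total f))
    rw [blockForm_apply]
    linarith

theorem total_single (i : Fin t) (x : ZMod n → ℚ) : total (Pi.single i x) = ∑ j, x j := by
  rw [total, Finset.sum_eq_single_of_mem i (Finset.mem_univ _)]
  · simp
  · intro j _ hj
    simp [hj]

theorem blockForm_single (a b : ℚ) (i : Fin t) (x : ZMod n → ℚ) (f : Fin t → ZMod n → ℚ) :
    blockForm n t a b (Pi.single i x) f =
      cycleForm n a x (f i) + b * ((∑ j, x j) * total f) := by
  rw [blockForm_apply, total_single, Finset.sum_eq_single_of_mem i (Finset.mem_univ _)]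
  · simp
  · intro j _ hj
    simp [hj]

/-- The vector that is constant on each block. -/
def blockConst (n : ℕ) (φ : Fin t → ℚ) : Fin t → ZMod n → ℚ := fun i => φ i • 1

theorem total_blockConst (φ : Fin t → ℚ) : total (blockConst n φ) = n * ∑ i, φ i := by
  simp [total, blockConst, ZMod.card, Finset.mul_sum]

theorem blockForm_blockConst (a b : ℚ) (φ ρ : Fin t → ℚ) :
    blockForm n t a b (blockConst n φ) (blockConst n ρ) =
      (a + 2) * n * ∑ i, φ i * ρ i + b * n ^ 2 * ((∑ i, φ i) * ∑ i, ρ i) := by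
  have h : ∀ i, cycleForm n a (blockConst n φ i) (blockConst n ρ i) =
      (a + 2) * n * (φ i * ρ i) := by
    intro i
    simp only [blockConst, map_smul, LinearMap.smul_apply, cycleForm_one, smul_eq_mul]
    simp [ZMod.card]
    ring
  rw [blockForm_apply, total_blockConst, total_blockConst, Finset.sum_congr rfl fun i _ => h i,
    ← Finset.mul_sum]
  ring

/-- The `j`-th vector of an orthogonal basis of the vectors with coordinate sum zero. -/
def stairVec (t j : ℕ) : Fin t → ℚ :=
  fun i => if (i : ℕ) ≤ j then 1 else if (i : ℕ) = j + 1 then -((j : ℚ) + 1) else 0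

theorem sum_stairVec_mul {j : ℕ} (hj : j + 1 < t) (ρ : ℕ → ℚ) :
    ∑ i : Fin t, stairVec t j i * ρ i = ∑ i ∈ Finset.range (j + 1), ρ i - (j + 1) * ρ (j + 1) := by
  have h : ∑ i : Fin t, stairVec t j i * ρ i = ∑ i ∈ Finset.range t,
      (if i ≤ j then 1 else if i = j + 1 then -((j : ℚ) + 1) else 0) * ρ i :=
    (Finset.sum_range (fun i : ℕ =>
      (if i ≤ j then 1 else if i = j + 1 then -((j : ℚ) + 1) else 0) * ρ i)).symm
  rw [h, ← Finset.sum_subset (Finset.range_mono (show j + 2 ≤ t by omega)),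
    Finset.sum_range_succ, if_neg (by omega), if_pos rfl]
  · rw [Finset.sum_congr rfl fun i hi => by
      rw [if_pos (by have := Finset.mem_range.mp hi; omega), one_mul]]
    ring
  · intro i _ hi
    rw [Finset.mem_range] at hi
    rw [if_neg (by omega), if_neg (by omega), zero_mul]

theorem sum_stairVec {j : ℕ} (hj : j + 1 < t) : ∑ i, stairVec t j i = 0 := by
  have := sum_stairVec_mul hj (fun _ => 1)
  simpa using this

/-- The later vector is constantly 1 on the support of the earlier one, which has sum zero. -/
theorem sum_stairVec_mul_stairVec {i j : ℕ} (hij : i < j) (hj : j + 1 < t) :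
    ∑ x, stairVec t i x * stairVec t j x = 0 := by
  have h1 : ∀ x : Fin t, stairVec t i x * stairVec t j x = stairVec t i x := by
    intro x
    by_cases hx : (x : ℕ) ≤ j
    · simp [stairVec, hx]
    · have h1 : ¬ (x : ℕ) ≤ i := by omega
      have h2 : ¬ (x : ℕ) = i + 1 := by omega
      simp [stairVec, h1, h2]
  rw [Finset.sum_congr rfl fun x _ => h1 x, sum_stairVec (by omega)]

theorem sum_stairVec_sq {j : ℕ} (hj : j + 1 < t) :
    ∑ x, stairVec t j x * stairVec t j x = (j + 1 : ℕ) * (j + 2 : ℕ) := by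
  have h := sum_stairVec_mul hj
    (fun i => if i ≤ j then 1 else if i = j + 1 then -((j : ℚ) + 1) else 0)
  refine Eq.trans ?_ (h.trans ?_)
  · rfl
  · rw [Finset.sum_congr rfl fun i hi => if_pos (by have := Finset.mem_range.mp hi; omega),
      if_neg (by omega), if_pos rfl]
    simp
    ring

/-- An explicit orthogonal basis for the block form. -/
theorem exists_isOrthoList_blockForm (hp2 : p ≠ 2) {y b k : ℤ} (hy : 5 ≤ y) (hpy : (p : ℤ) ∣ y)
    (hp3 : p = 3 → 9 ∣ y) (hb : 0 ≤ b) (hk : k ≠ 0) (hkk : k ^ 2 = y + b * (n * t)) (h : ℕ)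
    (hn : n = 2 * h + 1) (hpn : p ∣ n) (e : ℕ) (ht : t = 2 * e + 1) :
    ∃ l, IsOrthoList (blockForm n t (y - 2) b) l ∧ l.length = n * t ∧
      hasse p (norms (blockForm n t (y - 2) b) l) =
        ratHilbert p n (-1) * ratHilbert p y t * ratHilbert p y (-1) ^ e ∧
      ∃ c : ℚ, c ≠ 0 ∧ (norms (blockForm n t (y - 2) b) l).prod = c ^ 2 := by
  obtain ⟨m, hm, hmlen, hmh, c, hc, hmp⟩ := exists_isOrthoList_one_cons hp2 hy hpy hp3 h hn hpn
  set α := cycleForm n ((y : ℚ) - 2) with hα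
  set β := blockForm n t ((y : ℚ) - 2) b with hβdef
  have hy' : (5 : ℚ) ≤ y := by exact_mod_cast hy
  have hy0 : (y : ℚ) ≠ 0 := by linarith
  have hn0 : (n : ℚ) ≠ 0 := by rw [hn]; positivity
  have ht0 : (t : ℚ) ≠ 0 := by rw [ht]; positivity
  have hk0 : (k : ℚ) ≠ 0 := by exact_mod_cast hk
  have hαpos : IsPosDefForm α := cycleForm_isPosDefForm (by linarith)
  have hβpos : IsPosDefForm β := blockForm_isPosDefForm (by linarith) (by exact_mod_cast hb)
  obtain ⟨⟨-, h1m⟩, hm'⟩ := isOrthoList_cons.mp hm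
  have hsum : ∀ x ∈ m, ∑ j, x j = 0 := by
    intro x hx
    have := h1m x hx
    rw [hα, cycleForm_one, sub_add_cancel] at this
    exact (mul_eq_zero.mp this).resolve_left hy0
  -- Sum-zero vectors do not see the all-ones matrix, so on them the form is an orthogonal sum of
  -- cycle forms.
  have hsingle : ∀ (i : Fin t), ∀ x ∈ m, ∀ f, β (Pi.single i x) f = α x (f i) := by
    intro i x hx f
    rw [hβdef, blockForm_single, hsum x hx, zero_mul, mul_zero, add_zero]
  have hconst : ∀ (i : Fin t), ∀ x ∈ m, ∀ φ, β (Pi.single i x) (blockConst n φ) = 0 := by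
    intro i x hx φ
    rw [hsingle i x hx, blockConst, map_smul, hαpos.symm, h1m x hx, smul_zero]
  set A : List (Fin t → ZMod n → ℚ) := (List.finRange t).flatMap fun i => m.map (Pi.single i)
    with hA
  set Z : List (Fin t → ZMod n → ℚ) := (List.range (2 * e)).map fun j =>
    blockConst n (stairVec t j) with hZ
  set u : Fin t → ZMod n → ℚ := blockConst n (fun _ => 1) with hu
  have hZu : ∀ f ∈ Z ++ [u], ∃ φ, f = blockConst n φ := by
    intro f hf
    rcases List.mem_append.mp hf with hf | hf
    · obtain ⟨j, -, rfl⟩ := List.mem_map.mp hf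
      exact ⟨_, rfl⟩
    · exact ⟨_, List.mem_singleton.mp hf⟩
  have hzz : ∀ j < 2 * e, β (blockConst n (stairVec t j)) (blockConst n (stairVec t j)) =
      (y * n) * ((j + 1 : ℕ) * (j + 2 : ℕ)) := by
    intro j hj
    rw [hβdef, blockForm_blockConst, sum_stairVec (by omega), sum_stairVec_sq (by omega)]
    ring
  -- The relation for `k ^ 2` enters here: y·nt + b(nt)² = k²·nt.
  have huu : β u u = (k : ℚ) ^ 2 * (t * n) := by
    have : (k : ℚ) ^ 2 = y + b * (n * t) := by exact_mod_cast hkk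
    rw [hβdef, hu, blockForm_blockConst, this]
    simp
    ring
  have hpos : ∀ f, β f f ≠ 0 → f ≠ 0 := by rintro f hf rfl; simp at hf
  have hAortho : IsOrthoList β A := by
    constructor
    · rw [hA, List.pairwise_flatMap]
      constructor
      · intro i _
        rw [List.pairwise_map]
        refine hm'.ortho.imp_of_mem fun {x z} hx _ hxz => ?_
        rw [hsingle i x hx, Pi.single_eq_same, hxz]
      · refine (List.nodup_finRange t).imp fun {i j} hij => ?_
        intro f hf g hg
        obtain ⟨x, hx, rfl⟩ := List.mem_map.mp hf
        obtain ⟨z, hz, rfl⟩ := List.mem_map.mp hg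
        rw [hsingle i x hx, Pi.single_eq_of_ne hij, map_zero]
    · intro f hf
      obtain ⟨i, -, hf⟩ := List.mem_flatMap.mp hf
      obtain ⟨x, hx, rfl⟩ := List.mem_map.mp hf
      simpa using hm'.ne_zero x hx
  have hZortho : IsOrthoList β (Z ++ [u]) := by
    constructor
    · rw [List.pairwise_append, hZ, List.pairwise_map]
      refine ⟨?_, by simp, ?_⟩
      · refine List.pairwise_lt_range.imp_of_mem fun {i j} hi hj hij => ?_
        have hj' := List.mem_range.mp hj
        rw [hβdef, blockForm_blockConst, sum_stairVec (by omega),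
          sum_stairVec_mul_stairVec hij (by omega)]
        ring
      · intro f hf g hg
        obtain ⟨j, hj, rfl⟩ := List.mem_map.mp hf
        have hj' := List.mem_range.mp hj
        rw [List.mem_singleton.mp hg, hβdef, hu, blockForm_blockConst, sum_stairVec (by omega)]
        simp [sum_stairVec (show j + 1 < t by omega)]
    · intro f hf
      apply hpos
      rcases List.mem_append.mp hf with hf | hf
      · obtain ⟨j, hj, rfl⟩ := List.mem_map.mp hf
        rw [hzz j (List.mem_range.mp hj)]
        positivity
      · rw [List.mem_singleton.mp hf, huu]
        positivity
  have hl : IsOrthoList β (A ++ (Z ++ [u])) := by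
    refine ⟨List.pairwise_append.mpr ⟨hAortho.ortho, hZortho.ortho, ?_⟩, ?_⟩
    · intro f hf g hg
      obtain ⟨i, -, hf⟩ := List.mem_flatMap.mp hf
      obtain ⟨x, hx, rfl⟩ := List.mem_map.mp hf
      obtain ⟨φ, rfl⟩ := hZu g hg
      exact hconst i x hx φ
    · intro f hf
      rcases List.mem_append.mp hf with hf | hf
      · exact hAortho.ne_zero f hf
      · exact hZortho.ne_zero f hf
  have hnA : norms β A = (List.replicate (2 * e + 1) (norms α m)).flatten := by
    rw [hA, norms, List.map_flatMap, List.flatMap, ← ht]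
    congr 1
    rw [List.eq_replicate_iff]
    refine ⟨by simp, ?_⟩
    intro L hL
    obtain ⟨i, -, rfl⟩ := List.mem_map.mp hL
    rw [List.map_map, norms]
    refine List.map_congr_left fun x hx => ?_
    simp only [Function.comp_apply]
    rw [hsingle i x hx, Pi.single_eq_same]
  have hnZ : norms β (Z ++ [u]) = ((List.range (2 * e)).map fun j : ℕ =>
      (y * n : ℚ) * ((j + 1 : ℕ) * (j + 2 : ℕ) : ℚ)) ++ [(k : ℚ) ^ 2 * (t * n)] := by
    rw [norms, List.map_append, List.map_singleton, huu, hZ, List.map_map]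
    congr 1
    exact List.map_congr_left fun j hj => hzz j (List.mem_range.mp hj)
  have hyn0 : (y : ℚ) * n ≠ 0 := mul_ne_zero hy0 hn0
  have htn0 : (t : ℚ) * n ≠ 0 := mul_ne_zero ht0 hn0
  have hf0 : ((2 * e).factorial : ℚ) ≠ 0 := by exact_mod_cast (2 * e).factorial_ne_zero
  have h10 : (-1 : ℚ) ≠ 0 := by norm_num
  have hpA : (norms β A).prod = (c ^ t * n ^ e) ^ 2 * n := by
    rw [hnA, prod_flatten_replicate, hmp, mul_pow, ← ht, ht]; ring
  have hpZ : ((List.range (2 * e)).map fun j : ℕ =>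
      (y * n : ℚ) * ((j + 1 : ℕ) * (j + 2 : ℕ) : ℚ)).prod =
      ((2 * e).factorial * (y * n) ^ e) ^ 2 * t := by
    rw [prod_map_consecutive, ht]; ring
  have hpZu : (norms β (Z ++ [u])).prod =
      ((2 * e).factorial * (y * n) ^ e * k * t) ^ 2 * n := by
    rw [hnZ, List.prod_append, hpZ, List.prod_singleton]; ring
  have hcA : c ^ t * (n : ℚ) ^ e ≠ 0 := mul_ne_zero (pow_ne_zero _ hc) (pow_ne_zero _ hn0)
  have hcZ : ((2 * e).factorial : ℚ) * (y * n) ^ e ≠ 0 := mul_ne_zero hf0 (pow_ne_zero _ hyn0)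
  have hcZu : ((2 * e).factorial : ℚ) * (y * n) ^ e * k * t ≠ 0 :=
    mul_ne_zero (mul_ne_zero hcZ hk0) ht0
  have hnorms : norms β (A ++ (Z ++ [u])) = norms β A ++ norms β (Z ++ [u]) := List.map_append ..
  refine ⟨A ++ (Z ++ [u]), hl, ?_, ?_, (c ^ t * n ^ e) *
    ((2 * e).factorial * (y * n) ^ e * k * t) * n,
    mul_ne_zero (mul_ne_zero hcA hcZu) hn0, ?_⟩
  · have : A.length = t * (2 * h) := by
      rw [hA, List.length_flatMap]
      simp [hmlen]
    rw [List.length_append, this]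
    simp [hZ]
    rw [hn, ht]; ring
  -- `A` gives (n, -1)^e, the cross term of the discriminants gives (n, n) = (n, -1), and the
  -- constant vectors give (t, -1)(yn, t)(yn, -1)^e (t, tn). All but the claimed product cancels in
  -- pairs.
  · rw [hnorms, hasse_append hp2 (norms_ne_zero hβpos hAortho)
      (norms_prod_ne_zero hβpos hZortho), hpA, hpZu,
      ratHilbert_sq_mul_left hp2 hn0 (by positivity) hcA,
      ratHilbert_sq_mul_right hp2 hn0 hn0 hcZu, ratHilbert_self hp2 hn0, hnA,
      hasse_flatten_replicate hp2 (norms_ne_zero hαpos hm') hmh hc hn0 hmp, hnZ,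
      hasse_append_singleton hp2 (by
        intro a ha
        obtain ⟨j, -, rfl⟩ := List.mem_map.mp ha
        positivity) (by positivity), hpZ,
      ratHilbert_sq_mul_left hp2 ht0 (by positivity) hcZ,
      ratHilbert_sq_mul_right hp2 htn0 ht0 hk0,
      hasse_consecutive hp2 hyn0, ← ht, ratHilbert_mul_right hp2 ht0 hn0 ht0,
      ratHilbert_self hp2 ht0, ratHilbert_mul_left hp2 hy0 hn0 ht0,
      ratHilbert_mul_left hp2 hy0 hn0 h10, ratHilbert_comm hp2 ht0 hn0]
    have s1 := ratHilbert_mul_self (p := p) hp2 ht0 h10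
    have s2 := ratHilbert_mul_self (p := p) hp2 hn0 ht0
    have s3 := ratHilbert_mul_self (p := p) hp2 hn0 h10
    generalize ratHilbert p t (-1) = a1 at *
    generalize ratHilbert p n t = a2 at *
    generalize ratHilbert p n (-1) = a3 at *
    generalize ratHilbert p y (-1) = a4
    generalize ratHilbert p y t = a5
    calc _ = (a1 * a1) * (a2 * a2) * (a3 * a3) ^ e * (a3 * a5 * a4 ^ e) := by
          rw [mul_pow, mul_pow]; ring
      _ = _ := by rw [s1, s2, s3]; ring
  · rw [hnorms, List.prod_append, hpA, hpZu]; ring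

end BlockForm

end PairCovering

namespace PairCovering

/-! ### Identification with the integer matrix and the value of its invariant. -/

section BlockMatrix

variable {n : ℕ} [NeZero n] {t : ℕ}

/-- Numbering of the residues modulo `n`. -/
noncomputable def residueEquiv (n : ℕ) [NeZero n] : Fin n ≃ ZMod n :=
  Equiv.ofBijective (fun a : Fin n => ((a : ℕ) : ZMod n)) <| by
    rw [Fintype.bijective_iff_injective_and_card]
    refine ⟨fun a b h => ?_, by rw [Fintype.card_fin, ZMod.card]⟩
    have := (ZMod.natCast_eq_natCast_iff' _ _ _).mp h
    rw [Nat.mod_eq_of_lt a.2, Nat.mod_eq_of_lt b.2] at this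
    exact Fin.ext this

theorem residueEquiv_apply (a : Fin n) : residueEquiv n a = ((a : ℕ) : ZMod n) := rfl

/-- The standard basis, indexed by block and position. -/
noncomputable def blockBasis (n t : ℕ) [NeZero n] :
    Module.Basis (Σ _ : Fin t, Fin n) ℚ (Fin t → ZMod n → ℚ) :=
  (Pi.basis fun _ : Fin t => Pi.basisFun ℚ (ZMod n)).reindex
    (Equiv.sigmaCongrRight fun _ => (residueEquiv n).symm)

theorem blockBasis_apply (i : Fin t) (a : Fin n) :
    blockBasis n t ⟨i, a⟩ = Pi.single i (Pi.single (residueEquiv n a) 1) := by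
  rw [blockBasis, Module.Basis.reindex_apply]
  have : (Equiv.sigmaCongrRight fun _ : Fin t => (residueEquiv n).symm).symm ⟨i, a⟩ =
      ⟨i, residueEquiv n a⟩ := rfl
  rw [this, Pi.basis_apply, Pi.basisFun_apply]

theorem residueEquiv_add_one_eq_iff (a b : Fin n) :
    residueEquiv n a + 1 = residueEquiv n b ↔ ((a : ℕ) + 1) % n = b := by
  rw [residueEquiv_apply, residueEquiv_apply, ← Nat.cast_add_one, ZMod.natCast_eq_natCast_iff',
    Nat.mod_eq_of_lt b.2]

theorem matB_eq_cycleForm (hn : 2 ≤ n) (c : ℤ) (a b : Fin n) :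
    (matB n c a b : ℚ) =
      cycleForm n c (Pi.single (residueEquiv n a) 1) (Pi.single (residueEquiv n b) 1) := by
  have hs : ∀ x, (Pi.single (residueEquiv n b) 1 : ZMod n → ℚ) x =
      if x = residueEquiv n b then 1 else 0 := fun x => Pi.single_apply _ _ _
  have h1 : residueEquiv n a - 1 = residueEquiv n b ↔ ((b : ℕ) + 1) % n = a := by
    rw [← residueEquiv_add_one_eq_iff, sub_eq_iff_eq_add, eq_comm]
  rw [cycleForm_single, hs, hs, hs, matB, Matrix.of_apply]
  simp only [h1, residueEquiv_add_one_eq_iff, (residueEquiv n).injective.eq_iff]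
  by_cases hab : a = b
  · subst hab
    have h2 : ¬ ((a : ℕ) + 1) % n = a := by
      intro h
      rcases Nat.lt_or_ge ((a : ℕ) + 1) n with h' | h'
      · rw [Nat.mod_eq_of_lt h'] at h; omega
      · have : (a : ℕ) + 1 = n := by omega
        rw [this, Nat.mod_self] at h
        omega
    simp [h2]
  · simp only [hab, if_false, cycle]
    push_cast
    ring

theorem sum_cycle_mult (hn : 2 ≤ n) (a : Fin n) : ∑ b, (cycle n).mult a b = 2 := by
  have h : ∀ b, ((cycle n).mult a b : ℚ) =
      cycleForm n (0 : ℤ) (Pi.single (residueEquiv n a) 1) (Pi.single (residueEquiv n b) 1) := by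
    intro b
    rw [← matB_eq_cycleForm hn, matB, Matrix.of_apply]
    split_ifs with hab
    · rw [hab, (cycle n).loopless]; simp
    · simp
  have h1 : ∑ b, (Pi.single (residueEquiv n b) 1 : ZMod n → ℚ) = 1 := by
    rw [Equiv.sum_comp (residueEquiv n) fun x => (Pi.single x 1 : ZMod n → ℚ)]
    exact Finset.univ_sum_single 1
  have h2 : ((∑ b, (cycle n).mult a b : ℕ) : ℚ) = 2 := by
    push_cast
    rw [Finset.sum_congr rfl fun b _ => h b, ← map_sum, h1, cycleForm_single]
    simp
    norm_num
  exact_mod_cast h2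

theorem blockForm_blockBasis (hn : 2 ≤ n) (c b : ℤ) (i j : Fin t) (x z : Fin n) :
    blockForm n t c b (blockBasis n t ⟨i, x⟩) (blockBasis n t ⟨j, z⟩) =
      (((if i = j then matB n c x z else 0) + b : ℤ) : ℚ) := by
  rw [blockBasis_apply, blockBasis_apply, blockForm_single, total_single]
  push_cast
  split_ifs with h
  · subst h
    rw [Pi.single_eq_same, matB_eq_cycleForm hn]
    simp
  · rw [Pi.single_eq_of_ne h, map_zero]
    simp

theorem matX_eq_blockForm (hn : 2 ≤ n) (k l : ℕ) (x z : Fin (∑ _ : Fin t, n)) :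
    (matX k l (fun _ : Fin t => n) x z : ℚ) = blockForm n t ((k : ℤ) - l : ℤ) (l : ℤ)
      (blockBasis n t (finSigmaFinEquiv.symm x)) (blockBasis n t (finSigmaFinEquiv.symm z)) := by
  have h : matX k l (fun _ : Fin t => n) x z =
      Matrix.blockDiagonal' (fun _ : Fin t => matB n ((k : ℤ) - l))
        (finSigmaFinEquiv.symm x) (finSigmaFinEquiv.symm z) + l := by
    simp [matX]
  rw [h]
  generalize finSigmaFinEquiv.symm x = x'
  generalize finSigmaFinEquiv.symm z = z'
  obtain ⟨i, x'⟩ := x'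
  obtain ⟨j, z'⟩ := z'
  rw [blockForm_blockBasis hn]
  congr 2

variable {p : ℕ} [Fact p.Prime]

/-- Since the discriminant is a square, this removes the factor by which C_p differs from the Hasse
invariant. -/
theorem ratHilbert_neg_one_neg_sq (hp2 : p ≠ 2) {c : ℚ} (hc : c ≠ 0) :
    ratHilbert p (-1) (-c ^ 2) = 1 := by
  have h : (-1 : ℚ) ≠ 0 := by norm_num
  rw [show -c ^ 2 = c ^ 2 * (-1) by ring, ratHilbert_sq_mul_right hp2 h h hc]
  have := hilbert_eq_one_of_not_dvd hp2 (not_dvd_neg_one (p := p)) (not_dvd_neg_one (p := p))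
  rw [← ratHilbert_intCast] at this
  exact_mod_cast this

theorem finrank_block (n t : ℕ) [NeZero n] :
    Module.finrank ℚ (Fin t → ZMod n → ℚ) = n * t := by
  rw [Module.finrank_eq_card_basis (blockBasis n t)]
  simp [mul_comm]

theorem hasse_norms_eq {a b : ℚ} (hp2 : p ≠ 2) (hβ : IsPosDefForm (blockForm n t a b))
    {l m : List (Fin t → ZMod n → ℚ)} (hl : IsOrthoList (blockForm n t a b) l)
    (hm : IsOrthoList (blockForm n t a b) m) (hl' : l.length = n * t) (hm' : m.length = n * t) :
    SameClass p (norms (blockForm n t a b) l) (norms (blockForm n t a b) m) := by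
  refine sameClass_of_listSpan_eq hp2 hβ hl hm ?_
  rw [listSpan_eq_top hβ hl (by rw [hl', finrank_block]),
    listSpan_eq_top hβ hm (by rw [hm', finrank_block])]

/-- The value of the Hasse-Minkowski invariant of `matX`. -/
theorem hasseMinkowski_matX (hp2 : p ≠ 2) {k l : ℕ} (hkl : l + 2 < k) (hl : 0 < l)
    (hpy : (p : ℤ) ∣ (k : ℤ) - l + 2) (hp3 : p = 3 → (9 : ℤ) ∣ (k : ℤ) - l + 2)
    (hkk : (k : ℤ) ^ 2 = ((k : ℤ) - l + 2) + l * (n * t)) (h : ℕ)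
    (hn : n = 2 * h + 1) (hpn : p ∣ n) (e : ℕ) (ht : t = 2 * e + 1) :
    Nondegenerate (matX k l (fun _ : Fin t => n)) ∧
      hasseMinkowski p (matX k l (fun _ : Fin t => n)) =
        ratHilbert p n (-1) * ratHilbert p ((k : ℤ) - l + 2 : ℤ) t *
          ratHilbert p ((k : ℤ) - l + 2 : ℤ) (-1) ^ e ∧
      ∀ m, IsOrthoList (blockForm n t ((k : ℤ) - l : ℤ) (l : ℤ)) m → m.length = n * t →
        hasse p (norms (blockForm n t ((k : ℤ) - l : ℤ) (l : ℤ)) m) =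
          ratHilbert p n (-1) * ratHilbert p ((k : ℤ) - l + 2 : ℤ) t *
            ratHilbert p ((k : ℤ) - l + 2 : ℤ) (-1) ^ e := by
  have hn2 : 2 ≤ n := (Fact.out : p.Prime).two_le.trans (Nat.le_of_dvd (by omega) hpn)
  set y : ℤ := (k : ℤ) - l + 2 with hy
  have hy5 : 5 ≤ y := by omega
  have hya : (((k : ℤ) - l : ℤ) : ℚ) = (y : ℚ) - 2 := by rw [hy]; push_cast; ring
  rw [hya]
  have hβ : IsPosDefForm (blockForm n t ((y : ℚ) - 2) (l : ℤ)) := by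
    have : (5 : ℚ) ≤ y := by exact_mod_cast hy5
    exact blockForm_isPosDefForm (by linarith) (by positivity)
  obtain ⟨L, hL, hLlen, hLh, c, hc, hLp⟩ := exists_isOrthoList_blockForm (n := n) (t := t) hp2 hy5
    hpy hp3 (b := l) (k := k) (by positivity) (by omega) hkk h hn hpn e ht
  have hli : LinearIndependent ℚ fun x : Fin (∑ _ : Fin t, n) =>
      blockBasis n t (finSigmaFinEquiv.symm x) :=
    (blockBasis n t).linearIndependent.comp _ finSigmaFinEquiv.symm.injective
  obtain ⟨hnd, M, hM, hMlen, hMh⟩ := exists_isOrthoList_hasseMinkowski hp2 hβ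
    (matX k l (fun _ : Fin t => n)) _ hli (fun i j => by
      rw [matX_eq_blockForm hn2, hya])
  have hMlen' : M.length = n * t := by rw [hMlen]; simp [mul_comm]
  refine ⟨hnd, ?_, fun m hm hmlen => ?_⟩
  · obtain ⟨h1, d, hd, h2⟩ := hasse_norms_eq hp2 hβ hL hM hLlen hMlen'
    rw [hMh, ← h1, hLh, h2, hLp, ← mul_pow, ratHilbert_neg_one_neg_sq hp2 (mul_ne_zero hd hc),
      one_mul]
  · rw [← hLh]
    exact (hasse_norms_eq hp2 hβ hm hL hmlen hLlen).1

end BlockMatrix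

/-! ### Translation into Legendre symbols. -/

section LegendreValue

variable {p : ℕ} [Fact p.Prime]

theorem legendreSym_eq_one_or {u : ℤ} (hu : ¬ (p : ℤ) ∣ u) :
    legendreSym p u = 1 ∨ legendreSym p u = -1 :=
  legendreSym.eq_one_or_neg_one p (by rwa [Ne, ZMod.intCast_zmod_eq_zero_iff_dvd])

theorem legendreSym_neg_one_pow (e : ℕ) : legendreSym p ((-1) ^ e) = legendreSym p (-1) ^ e :=
  map_pow (legendreSym.hom p) _ _

/-- The Legendre symbol condition decides the value of the invariant. -/
theorem ratHilbert_product_eq (hp2 : p ≠ 2) {n t k l : ℕ} {y : ℤ} (hn : 0 < n) (hl : 0 < l)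
    (hk : 0 < k) (hy : y = (k : ℤ) - l + 2) (hkk : (k : ℤ) ^ 2 = y + l * (n * t))
    (e : ℕ) (ht : t = 2 * e + 1) (hpn : p ∣ n) (hpy : (p : ℤ) ∣ y) (s α nbar δ : ℕ)
    (hs : y = s * (p : ℤ) ^ α) (hsp : ¬ p ∣ s) (hnbar : n = nbar * p ^ δ) (hnbarp : ¬ p ∣ nbar) :
    (LegendreCondition p t s α nbar δ → ratHilbert p n (-1) * ratHilbert p y t *
      ratHilbert p y (-1) ^ e = -1) ∧
    (¬ LegendreCondition p t s α nbar δ → ratHilbert p n (-1) * ratHilbert p y t *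
      ratHilbert p y (-1) ^ e = 1) := by
  have hp : Prime (p : ℤ) := Nat.prime_iff_prime_int.mp Fact.out
  have hs' : ¬ (p : ℤ) ∣ s := by exact_mod_cast hsp
  have hnb' : ¬ (p : ℤ) ∣ nbar := by exact_mod_cast hnbarp
  have h2' : ¬ (p : ℤ) ∣ 2 := by
    intro h
    have h' : p ∣ 2 := by exact_mod_cast h
    exact hp2 ((Nat.prime_dvd_prime_iff_eq Fact.out Nat.prime_two).mp h')
  have hn' : (n : ℤ) = nbar * (p : ℤ) ^ δ := by rw [hnbar]; push_cast; ring
  have hpn' : (p : ℤ) ∣ n := by exact_mod_cast hpn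
  -- `p` divides `y` and `n`, hence `k ^ 2`. Then `l = k - y + 2` is 2 modulo `p`, the source of the
  -- 2 in the Legendre conditions.
  have hpk : (p : ℤ) ∣ k := by
    refine hp.dvd_of_dvd_pow (n := 2) ?_
    rw [hkk]
    exact dvd_add hpy ((hpn'.mul_right _).mul_left _)
  have hl2 : (p : ℤ) ∣ l - 2 := by
    rw [show (l : ℤ) - 2 = k - y by rw [hy]; ring]
    exact dvd_sub hpk hpy
  have hl' : ¬ (p : ℤ) ∣ l := fun h => h2' ((dvd_sub_right h).mp hl2)
  have hy0 : y ≠ 0 := by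
    rw [hs]
    refine mul_ne_zero (fun h => hs' (h ▸ dvd_zero _)) (pow_ne_zero _ hp.ne_zero)
  have hy0' : (y : ℚ) ≠ 0 := by exact_mod_cast hy0
  have hn0' : (n : ℚ) ≠ 0 := by exact_mod_cast hn.ne'
  have hl0' : (l : ℚ) ≠ 0 := by exact_mod_cast hl.ne'
  have hk0' : (k : ℚ) ≠ 0 := by exact_mod_cast hk.ne'
  have ht0' : (t : ℚ) ≠ 0 := by rw [ht]; positivity
  have hnt0 : (l : ℚ) * n ≠ 0 := mul_ne_zero hl0' hn0'
  -- Dividing `k ^ 2 = y + l * (n * t)` by `k ^ 2` gives two numbers with sum 1, so (y, lnt) = 1.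
  have hyt : ratHilbert p y t = ratHilbert p y l * ratHilbert p y n := by
    have h1 : ratHilbert p (y / (k : ℚ) ^ 2) ((l * n * t : ℚ) / (k : ℚ) ^ 2) = 1 := by
      refine ratHilbert_eq_one_of_add_eq_one hp2 (by positivity) (by positivity) ?_
      have : (k : ℚ) ^ 2 = y + l * (n * t) := by exact_mod_cast hkk
      rw [← add_div, div_eq_one_iff_eq (by positivity), this]
      ring
    have hki : (k : ℚ)⁻¹ ≠ 0 := inv_ne_zero hk0'
    rw [show (y : ℚ) / (k : ℚ) ^ 2 = ((k : ℚ)⁻¹) ^ 2 * y by field_simp,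
      show (l * n * t : ℚ) / (k : ℚ) ^ 2 = ((k : ℚ)⁻¹) ^ 2 * (l * n * t) by field_simp,
      ratHilbert_sq_mul_left hp2 hy0' (by positivity) hki,
      ratHilbert_sq_mul_right hp2 (mul_ne_zero hnt0 ht0') hy0' hki,
      ratHilbert_mul_right hp2 hnt0 ht0' hy0', ratHilbert_mul_right hp2 hl0' hn0' hy0'] at h1
    have h2 := ratHilbert_mul_self (p := p) hp2 hy0' ht0'
    linear_combination (ratHilbert p y l * ratHilbert p y n) * h2 - ratHilbert p y t * h1
  have e1 : ratHilbert p n (-1) = legendreSym p (-1) ^ δ := by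
    have := ratHilbert_intCast (p := p) n (-1)
    push_cast at this
    rw [this, hilbert_eq hp2 hn' hnb' (show (-1 : ℤ) = -1 * (p : ℤ) ^ 0 by simp) not_dvd_neg_one]
    simp
  have e2 : ratHilbert p y (-1) = legendreSym p (-1) ^ α := by
    have := ratHilbert_intCast (p := p) y (-1)
    push_cast at this
    rw [this, hilbert_eq hp2 hs hs' (show (-1 : ℤ) = -1 * (p : ℤ) ^ 0 by simp) not_dvd_neg_one]
    simp
  have e3 : ratHilbert p y l = legendreSym p 2 ^ α := by
    have := ratHilbert_intCast (p := p) y l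
    push_cast at this
    rw [this, hilbert_eq hp2 hs hs' (show (l : ℤ) = l * (p : ℤ) ^ 0 by simp) hl',
      legendreSym_congr hl2]
    simp
  have e4 : ratHilbert p y n = legendreSym p (-1) ^ (α * δ) * legendreSym p s ^ δ *
      legendreSym p nbar ^ α := by
    have := ratHilbert_intCast (p := p) y n
    push_cast at this
    rw [this, hilbert_eq hp2 hs hs' hn' hnb']
  have c1 : legendreSym p (-(s : ℤ)) = legendreSym p (-1) * legendreSym p s := by
    rw [← legendreSym.mul, neg_one_mul]
  have c2 : legendreSym p ((-1) ^ ((t - 1) / 2) * 2 * (nbar : ℤ)) =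
      legendreSym p (-1) ^ e * legendreSym p 2 * legendreSym p nbar := by
    rw [legendreSym.mul, legendreSym.mul, legendreSym_neg_one_pow,
      show (t - 1) / 2 = e by omega]
  have c3 : legendreSym p ((-1) ^ ((t - 1) / 2) * 2 * (s : ℤ) * (nbar : ℤ)) =
      legendreSym p (-1) ^ e * legendreSym p 2 * legendreSym p s * legendreSym p nbar := by
    rw [legendreSym.mul, legendreSym.mul, legendreSym.mul, legendreSym_neg_one_pow,
      show (t - 1) / 2 = e by omega]
  rw [LegendreCondition, c1, c2, c3, hyt, e1, e2, e3, e4]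
  have hpe : legendreSym p (-1) ^ e = 1 ∨ legendreSym p (-1) ^ e = -1 := by
    rcases legendreSym_eq_one_or (not_dvd_neg_one (p := p)) with h | h <;> rw [h]
    · simp
    · exact neg_one_pow_eq_or ℤ e
  rw [pow_right_comm _ α e]
  generalize legendreSym p (-1) ^ e = E at *
  have hA := legendreSym_eq_one_or (not_dvd_neg_one (p := p))
  have hB := legendreSym_eq_one_or h2'
  have hC := legendreSym_eq_one_or hs'
  have hD := legendreSym_eq_one_or hnb'
  generalize legendreSym p (-1) = A at *
  generalize legendreSym p 2 = B at *
  generalize legendreSym p s = C at *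
  generalize legendreSym p nbar = D at *
  rw [pow_mul]
  have even_pow : ∀ {x : ℤ} {m : ℕ}, (x = 1 ∨ x = -1) → Even m → x ^ m = 1 := by
    rintro x m (rfl | rfl) hm
    · simp
    · exact hm.neg_one_pow
  have odd_pow : ∀ {x : ℤ} {m : ℕ}, (x = 1 ∨ x = -1) → Odd m → x ^ m = x := by
    rintro x m (rfl | rfl) hm
    · simp
    · exact hm.neg_one_pow
  -- All bases are signs, so only the parities of the exponents matter. With both even the value is
  -- identically 1, which is why the condition has no such case.
  rcases Nat.even_or_odd α with hα | hα <;> rcases Nat.even_or_odd δ with hδ | hδ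
  · have n1 : ¬ Odd α := Nat.not_odd_iff_even.mpr hα
    have n2 : ¬ Odd δ := Nat.not_odd_iff_even.mpr hδ
    simp [even_pow hA hα, even_pow hA hδ, even_pow hB hα, even_pow hC hδ, even_pow hD hα,
      even_pow hpe hα, n1, n2]
  · have n1 : ¬ Odd α := Nat.not_odd_iff_even.mpr hα
    simp only [even_pow hA hα, odd_pow hA hδ, even_pow hB hα, odd_pow hC hδ, even_pow hD hα,
      even_pow hpe hα, n1, hα, hδ, true_and, false_and, or_false, one_pow, mul_one, one_mul]
    rcases hA with rfl | rfl <;> rcases hC with rfl | rfl <;> simp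
  · have n1 : ¬ Even α := Nat.not_even_iff_odd.mpr hα
    have n2 : ¬ Odd δ := Nat.not_odd_iff_even.mpr hδ
    simp only [odd_pow hA hα, even_pow hA hδ, odd_pow hB hα, even_pow hC hδ, odd_pow hD hα,
      odd_pow hpe hα, n1, n2, hα, hδ, true_and, false_and, or_false, false_or, mul_one, one_mul]
    rcases hB with rfl | rfl <;> rcases hD with rfl | rfl <;> rcases hpe with rfl | rfl <;> simp
  · have n1 : ¬ Even α := Nat.not_even_iff_odd.mpr hα
    have n2 : ¬ Even δ := Nat.not_even_iff_odd.mpr hδ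
    simp only [odd_pow hA hα, odd_pow hA hδ, odd_pow hB hα, odd_pow hC hδ, odd_pow hD hα,
      odd_pow hpe hα, n1, n2, hα, hδ, true_and, false_and, false_or]
    rcases hA with rfl | rfl <;> rcases hB with rfl | rfl <;> rcases hC with rfl | rfl <;>
      rcases hD with rfl | rfl <;> rcases hpe with rfl | rfl <;> simp

end LegendreValue

end PairCovering

namespace PairCovering

/-! ### Incidence matrices and orthonormal bases. -/

section Incidence

variable {V : Type*} [DecidableEq V]

theorem pairCount_coe (L : List (Finset V)) (x z : V) :
    pairCount (L : Multiset (Finset V)) x z =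
      ∑ b : Fin L.length, if x ∈ L.get b ∧ z ∈ L.get b then 1 else 0 := by
  rw [pairCount, Multiset.coe_countP]
  induction L with
  | nil => simp
  | cons B L ih =>
    rw [List.countP_cons, ih]
    change _ = ∑ b : Fin (L.length + 1), _
    rw [Fin.sum_univ_succ, add_comm]
    congr 1
    by_cases hB : x ∈ B ∧ z ∈ B <;> simp [hB]

variable {n t : ℕ} [NeZero n]

/-- The incidence matrix of a covering yields an orthonormal basis. -/
theorem exists_isOrthoList_of_pairCount {a b : ℚ} (hβ : IsPosDefForm (blockForm n t a b))
    (L : List (Finset V)) (hLlen : L.length = n * t) (e : (Σ _ : Fin t, Fin n) ≃ V)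
    (h : ∀ x z, (pairCount (L : Multiset (Finset V)) (e x) (e z) : ℚ) =
      blockForm n t a b (blockBasis n t x) (blockBasis n t z)) :
    ∃ l, IsOrthoList (blockForm n t a b) l ∧ l.length = n * t ∧
      ∀ c ∈ norms (blockForm n t a b) l, c = 1 := by
  set β := blockForm n t a b with hβdef
  -- Each point goes to the indicator vector of the blocks through it, so pair counts become dot
  -- products.
  set φ : (Fin t → ZMod n → ℚ) →ₗ[ℚ] (Fin L.length → ℚ) :=
    (blockBasis n t).constr ℚ fun x c => if e x ∈ L.get c then 1 else 0 with hφ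
  have hφβ : ∀ f g, β f g = ∑ c, φ f c * φ g c := by
    have : β = ∑ c, LinearMap.BilinForm.linMulLin ((LinearMap.proj c).comp φ)
        ((LinearMap.proj c).comp φ) := by
      refine (blockBasis n t).ext fun x => (blockBasis n t).ext fun z => ?_
      rw [← h, pairCount_coe]
      simp only [LinearMap.sum_apply, LinearMap.BilinForm.linMulLin_apply, LinearMap.comp_apply,
        LinearMap.proj_apply, hφ, Module.Basis.constr_basis]
      push_cast
      refine Finset.sum_congr rfl fun c _ => ?_
      by_cases h1 : e x ∈ L.get c <;> by_cases h2 : e z ∈ L.get c <;> simp_all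
    intro f g
    rw [this]
    simp [LinearMap.sum_apply]
  -- Positive definiteness gives injectivity; having as many blocks as points then makes `φ` an
  -- isometry onto the standard space.
  have hinj : Function.Injective φ := by
    rw [← LinearMap.ker_eq_bot, LinearMap.ker_eq_bot']
    intro f hf
    by_contra h0
    have := hβ.pos f h0
    rw [hφβ, hf] at this
    simp at this
  have hfin : Module.finrank ℚ (Fin t → ZMod n → ℚ) = Module.finrank ℚ (Fin L.length → ℚ) := by
    rw [finrank_block, Module.finrank_fin_fun, hLlen]
  set Φ := LinearEquiv.ofInjectiveOfFinrankEq φ hinj hfin with hΦ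
  have hsymm : ∀ v, φ (Φ.symm v) = v := fun v => Φ.apply_symm_apply v
  have hval : ∀ c d, β (Φ.symm (Pi.single c 1)) (Φ.symm (Pi.single d 1)) =
      if c = d then 1 else 0 := by
    intro c d
    rw [hφβ, hsymm, hsymm]
    simp [Pi.single_apply, eq_comm]
  refine ⟨(List.finRange L.length).map fun c => Φ.symm (Pi.single c 1), ⟨?_, ?_⟩,
    by simp [hLlen], ?_⟩
  · rw [List.pairwise_map]
    exact (List.nodup_finRange _).imp fun {c d} hcd => by rw [hval, if_neg hcd]
  · intro f hf
    obtain ⟨c, -, rfl⟩ := List.mem_map.mp hf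
    simp
  · intro x hx
    obtain ⟨f, hf, rfl⟩ := List.mem_map.mp hx
    obtain ⟨c, -, rfl⟩ := List.mem_map.mp hf
    rw [hval, if_pos rfl]

variable [Fintype V]

/-- Each block through `x` is counted once for each of its `k` points. -/
theorem sum_pairCount {k : ℕ} (L : List (Finset V)) (hL : ∀ B ∈ L, B.card = k) (x : V) :
    ∑ z, pairCount (L : Multiset (Finset V)) x z = k * pairCount (L : Multiset (Finset V)) x x := by
  simp only [pairCount_coe]
  rw [Finset.sum_comm, Finset.mul_sum]
  refine Finset.sum_congr rfl fun b _ => ?_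
  by_cases hx : x ∈ L.get b
  · simp only [hx, true_and, and_self, if_true, mul_one]
    rw [Finset.sum_ite_mem, Finset.univ_inter, Finset.sum_const, smul_eq_mul, mul_one,
      hL _ (List.get_mem L b)]
  · simp only [hx, false_and, if_false, Finset.sum_const_zero, mul_zero]

/-- The pair counts of a symmetric covering whose excess is a union of `n`-cycles. -/
theorem pairCount_eq_blockForm {k l : ℕ} {L : List (Finset V)} (hn : 2 ≤ n)
    (hk : 2 ≤ k) (hcard : Fintype.card V = n * t) (hL : ∀ B ∈ L, B.card = k)
    (hcov : ∀ x z : V, x ≠ z → l ≤ pairCount (L : Multiset (Finset V)) x z)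
    (hkk : (k : ℤ) ^ 2 = ((k : ℤ) - l + 2) + l * (n * t))
    (e : (Σ _ : Fin t, Fin n) ≃ V)
    (he1 : ∀ i a b, (excess l (L : Multiset (Finset V))).mult (e ⟨i, a⟩) (e ⟨i, b⟩) =
      (cycle n).mult a b)
    (he2 : ∀ i j, i ≠ j → ∀ a b,
      (excess l (L : Multiset (Finset V))).mult (e ⟨i, a⟩) (e ⟨j, b⟩) = 0)
    (i j : Fin t) (a b : Fin n) :
    (pairCount (L : Multiset (Finset V)) (e ⟨i, a⟩) (e ⟨j, b⟩) : ℚ) =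
      blockForm n t ((k : ℤ) - l : ℤ) (l : ℤ) (blockBasis n t ⟨i, a⟩) (blockBasis n t ⟨j, b⟩) := by
  have hmult : ∀ x z : V, x ≠ z → pairCount (L : Multiset (Finset V)) x z =
      (excess l (L : Multiset (Finset V))).mult x z + l := by
    intro x z hxz
    have := hcov x z hxz
    simp only [excess, if_neg hxz]
    omega
  rw [blockForm_blockBasis hn]
  by_cases hij : (⟨i, a⟩ : Σ _ : Fin t, Fin n) = ⟨j, b⟩
  · have hji : i = j := congrArg Sigma.fst hij
    subst hji
    have hab : a = b := by simpa using hij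
    subst hab
    have hdeg : ∑ z, (excess l (L : Multiset (Finset V))).mult (e ⟨i, a⟩) z = 2 := by
      rw [← Equiv.sum_comp e, Fintype.sum_sigma, Finset.sum_eq_single_of_mem i (Finset.mem_univ _)]
      · rw [Finset.sum_congr rfl fun b _ => he1 i a b, sum_cycle_mult hn]
      · intro j _ hj
        exact Finset.sum_eq_zero fun b _ => he2 i j hj.symm a b
    set x := e ⟨i, a⟩
    have h1 := sum_pairCount L hL x
    rw [← Finset.add_sum_erase _ _ (Finset.mem_univ x)] at h1 hdeg
    rw [Finset.sum_congr rfl fun z hz => hmult x z (Finset.ne_of_mem_erase hz).symm,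
      Finset.sum_add_distrib, Finset.sum_const, Finset.card_erase_of_mem (Finset.mem_univ _),
      Finset.card_univ, hcard, smul_eq_mul] at h1
    rw [(excess l (L : Multiset (Finset V))).loopless, zero_add] at hdeg
    rw [hdeg] at h1
    have hpos : 1 ≤ n * t := by
      exact Nat.mul_pos (by omega) i.pos
    -- The excess has degree 2, so the other pair counts at `x` sum to l(nt - 1) + 2 = k(k - 1).
    -- With r blocks through `x` this sum is also (k - 1)r, hence r = k.
    have h2 : pairCount (L : Multiset (Finset V)) x x = k := by
      zify [hpos] at h1
      have hk1 : (k : ℤ) - 1 ≠ 0 := by omega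
      have : ((pairCount (L : Multiset (Finset V)) x x : ℕ) : ℤ) = k := by
        apply mul_left_cancel₀ hk1
        linear_combination (-1 : ℤ) * h1 - hkk
      exact_mod_cast this
    rw [h2, if_pos rfl, matB, Matrix.of_apply, if_pos rfl]
    push_cast
    ring
  · rw [hmult _ _ (fun h => hij (e.injective h))]
    by_cases hji : i = j
    · subst hji
      have hab : a ≠ b := fun h => hij (by rw [h])
      rw [he1, if_pos rfl, matB, Matrix.of_apply, if_neg hab]
      push_cast
      ring
    · rw [he2 i j hji, if_neg hji]
      push_cast
      ring

variable {p : ℕ} [Fact p.Prime]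

theorem hasse_eq_one_of_forall_eq_one (hp2 : p ≠ 2) {L : List ℚ} (h : ∀ a ∈ L, a = 1) :
    hasse p L = 1 := by
  induction L with
  | nil => rfl
  | cons a L ih =>
    have hL : ∀ b ∈ L, b = 1 := fun b hb => h b (by simp [hb])
    rw [hasse, ih hL, h a (by simp), List.prod_eq_one hL, mul_one]
    exact ratHilbert_one_left hp2 one_ne_zero

end Incidence

end PairCovering

/-! ### Nonexistence, and the value of C_p. -/

theorem mainTheorem4 (n t k l : ℕ) (hn : 0 < n) (ht : 0 < t) (hk : 0 < k) (hl : 0 < l)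
    (hkl : l + 2 < k) (hv : (n : ℚ) * t = ((k : ℚ) * (k - 1) - 2) / l + 1) (hodd : Odd (n * t))
    (p : ℕ) [Fact p.Prime] (hp2 : p ≠ 2) (hpk : p ∣ k - l + 2) (hpn : p ∣ n)
    (hp3 : p = 3 → 9 ∣ k - l + 2)
    (s α nbar δ : ℕ) (hs : k - l + 2 = s * p ^ α) (hsp : ¬ p ∣ s)
    (hnbar : n = nbar * p ^ δ) (hnbarp : ¬ p ∣ nbar) :
    (PairCovering.LegendreCondition p t s α nbar δ →
      ∀ (V : Type*) [Fintype V] [DecidableEq V] (blocks : Multiset (Finset V)),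
        PairCovering.IsSymmetricCovering (n * t) k l blocks →
          ¬ (PairCovering.excess l blocks).HasCycleType (fun _ : Fin t => n)) ∧
    (¬ PairCovering.LegendreCondition p t s α nbar δ →
      PairCovering.Nondegenerate (PairCovering.matX k l (fun _ : Fin t => n)) ∧
        PairCovering.hasseMinkowski p (PairCovering.matX k l (fun _ : Fin t => n)) = 1) := by
  have : NeZero n := ⟨hn.ne'⟩
  have hyc : ((k - l + 2 : ℕ) : ℤ) = (k : ℤ) - l + 2 := by
    rw [Nat.cast_add, Nat.cast_sub (by omega)]; rfl
  have hpy : (p : ℤ) ∣ (k : ℤ) - l + 2 := by rw [← hyc]; exact_mod_cast hpk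
  have hp3' : p = 3 → (9 : ℤ) ∣ (k : ℤ) - l + 2 := fun h => by
    rw [← hyc]; exact_mod_cast hp3 h
  have hs' : (k : ℤ) - l + 2 = s * (p : ℤ) ^ α := by rw [← hyc, hs]; push_cast; ring
  have hkk : (k : ℤ) ^ 2 = ((k : ℤ) - l + 2) + l * (n * t) := by
    have hl0 : (l : ℚ) ≠ 0 := by exact_mod_cast hl.ne'
    have : (k : ℚ) ^ 2 = ((k : ℚ) - l + 2) + l * (n * t) := by
      rw [hv]; field_simp; ring
    exact_mod_cast this
  obtain ⟨h, hh⟩ := (Nat.odd_mul.mp hodd).1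
  obtain ⟨e, he⟩ := (Nat.odd_mul.mp hodd).2
  obtain ⟨hnd, hval, hlist⟩ := PairCovering.hasseMinkowski_matX hp2 hkl hl hpy hp3' hkk h hh hpn e he
  obtain ⟨hneg, hone⟩ := PairCovering.ratHilbert_product_eq hp2 hn hl hk rfl hkk e he hpn hpy s α nbar δ
    hs' hsp hnbar hnbarp
  refine ⟨fun hL V _ _ blocks hcov hcyc => ?_, fun hL => ⟨hnd, hval.trans (hone hL)⟩⟩
  obtain ⟨-, e', he1, he2⟩ := hcyc
  have hn2 : 2 ≤ n := (Fact.out : p.Prime).two_le.trans (Nat.le_of_dvd hn hpn)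
  obtain ⟨L, rfl⟩ := Quot.exists_rep blocks
  have hβ : PairCovering.IsPosDefForm
      (PairCovering.blockForm n t ((k : ℤ) - l : ℤ) (l : ℤ)) := by
    refine PairCovering.blockForm_isPosDefForm ?_ (by positivity)
    have : (2 : ℤ) < (k : ℤ) - l := by omega
    exact_mod_cast this
  obtain ⟨m, hm, hmlen, hm1⟩ := PairCovering.exists_isOrthoList_of_pairCount hβ L
    hcov.card_blocks e' (fun x z => PairCovering.pairCount_eq_blockForm hn2 (by omega)
      hcov.card_points hcov.card_block hcov.covers hkk e' he1 he2 x.1 z.1 x.2 z.2)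
  -- The orthonormal basis has Hasse invariant 1, whereas under (L) every orthogonal basis has Hasse
  -- invariant -1.
  have h1 := PairCovering.hasse_eq_one_of_forall_eq_one (p := p) hp2 hm1
  rw [hlist m hm hmlen, hneg hL] at h1
  norm_num at h1
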